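/- Let $(N^{2n+1},\varphi,\xi,\eta,g)$ be a Sasakian space form of constant $\varphi$-sectional curvature $c\neq 1$. (Sasakian means: $\varphi,\xi,\eta$ and the Riemannian metric $g$ are smooth, $\varphi^2=-I+\eta\otimes\xi$, $\eta(\xi)=1$, $g(\varphi X,\varphi Y)=g(X,Y)-\eta(X)\eta(Y)$, $g(X,\varphi Y)=d\eta(X,Y)$ with $d\eta(X,Y)=\frac12\big(X\eta(Y)-Y\eta(X)-\eta([X,Y])\big)$, and $N_\varphi+2\,d\eta\otimes\xi=0$, where $N_\varphi$ is the Nijenhuis tensor of $\varphi$. Constant $\varphi$-sectional curvature $c$ means that every plane spanned by $u,\varphi u$ with $u$ a unit vector orthogonal to $\xi$ has sectional curvature $c$.) Let $J\subseteq\mathbb R$ be a non-empty open interval and let $\gamma:J\to N$ be a smooth Legendre Frenet curve of osculating order $r$, $1\le r\le 2n+1$: $\gamma$ is parametrized by arc length, $\eta(\gamma')=0$, and there are smooth orthonormal vector fields $E_1=\gamma'=T,E_2,\dots,E_r$ along $\gamma$ and smooth positive functions $\kappa_1,\dots,\kappa_{r-1}$ on $J$ with $\nabla_TE_i=-\kappa_{i-1}E_{i-1}+\kappa_iE_{i+1}$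 for $1\le i\le r$ (the first term is absent for $i=1$ and the second for $i=r$), $\nabla$ being the Levi-Civita connection of $g$. Assume that the function $g(E_2,\varphi T)$ on $J$ is not identically $0$, not identically $1$ and not identically $-1$ (no condition if $r=1$, when $E_2$ does not exist). Call $\gamma$ a geodesic (equivalently, harmonic) if $\nabla_TT=0$, biharmonic if $\nabla_T^3T-R(T,\nabla_TT)T=0$, where $R(X,Y)=\nabla_X\nabla_Y-\nabla_Y\nabla_X-\nabla_{[X,Y]}$, and proper-biharmonic if it is biharmonic but not harmonic. Then: 1) If $c\le -3$, then $\gamma$ is biharmonic if and only if it is a geodesic. 2) If $c>-3$, then $\gamma$ is proper-biharmonic if and only if $r\ge 4$ and there is a constant $\alpha_0\in(0,2\pi)\setminus\{\frac{\pi}{2},\pi,\frac{3\pi}{2}\}$ with $$c+3+3(c-1)\cos^2\alpha_0>0,\qquad 3(c-1)\sin(2\alpha_0)<0,$$ such that $\varphi T=\cos\alpha_0\,E_2+\sin\alpha_0\,E_4$ along $\gamma$, the curvatures $\kappa_1,\kappa_2,\kappa_3$ are positive constants, and $$\kappa_1^2+\kappa_2^2=\frac{c+3}{4}+\frac{3(c-1)}{4}\cos^2\alpha_0,\qquad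 \kappa_2\kappa_3=-\frac{3(c-1)}{8}\sin(2\alpha_0).$$ -/

import Mathlib

open scoped Manifold ContDiff

noncomputable section

namespace Sasaki

/-! ### Riemannian geometry in the preferred charts of a smooth manifold -/

section Riemannian

variable {m : ℕ} {N : Type*} [TopologicalSpace N]
  [ChartedSpace (EuclideanSpace ℝ (Fin m)) N] [IsManifold (𝓡 m) ∞ N]

variable (m N) in
/-- Smooth Riemannian metrics on the `m`-dimensional manifold `N`. -/
abbrev Metric : Type _ :=
  Bundle.ContMDiffRiemannianMetric (𝓡 m) ∞ (EuclideanSpace ℝ (Fin m))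
    (fun q : N => TangentSpace (𝓡 m) q)

/-- The coordinates, in the preferred chart at `p`, of a tangent vector `v` at `q`
(for `q` in the domain of that chart). -/
def coords (p : N) {q : N} (v : TangentSpace (𝓡 m) q) : EuclideanSpace ℝ (Fin m) :=
  (trivializationAt (EuclideanSpace ℝ (Fin m)) (TangentSpace (𝓡 m)) p).continuousLinearMapAt ℝ q v

/-- The tangent vector at `q` with coordinates `u` in the preferred chart at `p`
(for `q` in the domain of that chart). -/
def ofCoords (p q : N) : EuclideanSpace ℝ (Fin m) →L[ℝ] TangentSpace (𝓡 m) q :=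
  (trivializationAt (EuclideanSpace ℝ (Fin m)) (TangentSpace (𝓡 m)) p).symmL ℝ q

/-- The metric in the preferred chart at `p`: `metricCoord g p x u v = g_{ij}(x) uⁱ vʲ`. -/
def metricCoord (g : Metric m N) (p : N) (x : EuclideanSpace ℝ (Fin m)) :
    EuclideanSpace ℝ (Fin m) →L[ℝ] EuclideanSpace ℝ (Fin m) →L[ℝ] ℝ :=
  ((ofCoords p ((extChartAt (𝓡 m) p).symm x)).precomp ℝ).comp
    ((g.inner ((extChartAt (𝓡 m) p).symm x)).comp (ofCoords p ((extChartAt (𝓡 m) p).symm x)))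

/-- The Christoffel symbols of the Levi-Civita connection in the preferred chart at `p`:
`christoffel g p x u v` is the vector `Γᵏ_{ij}(x) uⁱ vʲ`, determined by
`g_x(Γ(u, v), w) = ½ ((∂_u g)(v, w) + (∂_v g)(u, w) - (∂_w g)(u, v))` for all `w`. -/
def christoffel (g : Metric m N) (p : N) (x u v : EuclideanSpace ℝ (Fin m)) :
    EuclideanSpace ℝ (Fin m) :=
  (metricCoord g p x).inverse
    ((1 / 2 : ℝ) • (fderiv ℝ (metricCoord g p) x u v + fderiv ℝ (metricCoord g p) x v u
      - ((fderiv ℝ (metricCoord g p) x).flip u).flip v))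

/-- The curvature tensor `R(u, v)w = ∇_u ∇_v w - ∇_v ∇_u w - ∇_{[u, v]} w` at `p`, computed in the
preferred chart at `p` (where coordinate fields commute):
`R(u, v)w = (∂_u Γ)(v, w) - (∂_v Γ)(u, w) + Γ(u, Γ(v, w)) - Γ(v, Γ(u, w))`. -/
def curvature (g : Metric m N) (p : N) (u v w : TangentSpace (𝓡 m) p) : TangentSpace (𝓡 m) p :=
  ofCoords p p
    (fderiv ℝ (fun y => christoffel g p y (coords p v) (coords p w))
        (extChartAt (𝓡 m) p p) (coords p u)
      - fderiv ℝ (fun y => christoffel g p y (coords p u) (coords p w))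
        (extChartAt (𝓡 m) p p) (coords p v)
      + christoffel g p (extChartAt (𝓡 m) p p) (coords p u)
        (christoffel g p (extChartAt (𝓡 m) p p) (coords p v) (coords p w))
      - christoffel g p (extChartAt (𝓡 m) p p) (coords p v)
        (christoffel g p (extChartAt (𝓡 m) p p) (coords p u) (coords p w)))

/-- The velocity field `T = γ'` of a curve. -/
def velocity (γ : ℝ → N) (t : ℝ) : TangentSpace (𝓡 m) (γ t) :=
  mfderiv 𝓘(ℝ, ℝ) (𝓡 m) γ t (1 : ℝ)

/-- The covariant derivative `∇_T V` of a vector field `V` along the curve `γ`, for the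
Levi-Civita connection of `g`; in the preferred chart at `γ t` it is
`dVᵏ/dt + Γᵏ_{ij} (γ')ⁱ Vʲ`. -/
def covDeriv (g : Metric m N) (γ : ℝ → N) (V : ∀ t, TangentSpace (𝓡 m) (γ t)) (t : ℝ) :
    TangentSpace (𝓡 m) (γ t) :=
  ofCoords (γ t) (γ t)
    (deriv (fun s => coords (γ t) (V s)) t
      + christoffel g (γ t) (extChartAt (𝓡 m) (γ t) (γ t))
        (coords (γ t) (velocity γ t)) (coords (γ t) (V t)))

/-- The tension field `τ(γ) = trace ∇dγ = ∇_T T` of a curve `γ : (J, dt²) → (N, g)`. -/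
def tension (g : Metric m N) (γ : ℝ → N) (t : ℝ) : TangentSpace (𝓡 m) (γ t) :=
  covDeriv g γ (velocity γ) t

/-- The bitension field of a curve `γ : (J, dt²) → (N, g)`,
`τ₂(γ) = -Δτ(γ) - trace R(dγ, τ(γ))dγ = ∇_T ∇_T τ(γ) - R(T, τ(γ))T`. -/
def bitension (g : Metric m N) (γ : ℝ → N) (t : ℝ) : TangentSpace (𝓡 m) (γ t) :=
  covDeriv g γ (covDeriv g γ (tension g γ)) t
    - curvature g (γ t) (velocity γ t) (tension g γ t) (velocity γ t)

/-- `γ` is harmonic on `J`: `τ(γ) = 0`. -/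
def IsHarmonic (g : Metric m N) (J : Set ℝ) (γ : ℝ → N) : Prop :=
  ∀ t ∈ J, tension g γ t = 0

/-- `γ` is biharmonic on `J`: `τ₂(γ) = 0`. -/
def IsBiharmonic (g : Metric m N) (J : Set ℝ) (γ : ℝ → N) : Prop :=
  ∀ t ∈ J, bitension g γ t = 0

/-- Proper-biharmonic means biharmonic but not harmonic. -/
def IsProperBiharmonic (g : Metric m N) (J : Set ℝ) (γ : ℝ → N) : Prop :=
  IsBiharmonic g J γ ∧ ¬ IsHarmonic g J γ

/-- `γ` is a geodesic on `J`: `∇_T T = 0`. -/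
def IsGeodesic (g : Metric m N) (J : Set ℝ) (γ : ℝ → N) : Prop :=
  ∀ t ∈ J, covDeriv g γ (velocity γ) t = 0

/-- `γ` is, on the open interval `J`, a Frenet curve of osculating order `r`, `1 ≤ r ≤ dim N`,
with Frenet frame `E 1, …, E r` and curvatures `κ 1, …, κ (r - 1)`; the values of `E i` and `κ i`
at other indices are irrelevant. Since `T = E 1` is a unit field, `γ` is parametrized by arc
length. -/
structure IsFrenetCurve (g : Metric m N) (J : Set ℝ) (γ : ℝ → N) (r : ℕ)
    (E : ℕ → ∀ t, TangentSpace (𝓡 m) (γ t)) (κ : ℕ → ℝ → ℝ) : Prop where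
  one_le : 1 ≤ r
  le_dim : r ≤ m
  smooth_curve : ContMDiffOn 𝓘(ℝ, ℝ) (𝓡 m) ∞ γ J
  smooth_frame : ∀ i, 1 ≤ i → i ≤ r → ContMDiffOn 𝓘(ℝ, ℝ) (𝓡 m).tangent ∞
    (fun t => (⟨γ t, E i t⟩ : TangentBundle (𝓡 m) N)) J
  smooth_curvature : ∀ i, 1 ≤ i → i < r → ContDiffOn ℝ ∞ (κ i) J
  frame_one : ∀ t ∈ J, E 1 t = velocity γ t
  orthonormal : ∀ t ∈ J, ∀ i j, 1 ≤ i → i ≤ r → 1 ≤ j → j ≤ r →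
    g.inner (γ t) (E i t) (E j t) = if i = j then 1 else 0
  curvature_pos : ∀ t ∈ J, ∀ i, 1 ≤ i → i < r → 0 < κ i t
  /-- `∇_T E_i = -κ_{i-1} E_{i-1} + κ_i E_{i+1}`, the first term being absent for `i = 1` and the
  second one for `i = r`. -/
  frenet : ∀ t ∈ J, ∀ i, 1 ≤ i → i ≤ r → covDeriv g γ (E i) t =
    (if 1 < i then -(κ (i - 1) t) • E (i - 1) t else 0)
      + (if i < r then κ i t • E (i + 1) t else 0)

end Riemannian

/-! ### Sasakian manifolds -/

section Contact

variable {m : ℕ} {N : Type*} [TopologicalSpace N]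
  [ChartedSpace (EuclideanSpace ℝ (Fin m)) N] [IsManifold (𝓡 m) ∞ N]

/-- The vector field `X` is smooth at `p`. -/
def SmoothFieldAt (X : ∀ q : N, TangentSpace (𝓡 m) q) (p : N) : Prop :=
  ContMDiffAt (𝓡 m) (𝓡 m).tangent ∞ (fun q => (⟨q, X q⟩ : TangentBundle (𝓡 m) N)) p

/-- The derivative `u(f)` of a function `f` in the direction of a tangent vector `u` at `p`. -/
def dirDeriv (f : N → ℝ) {p : N} (u : TangentSpace (𝓡 m) p) : ℝ :=
  mfderiv (𝓡 m) 𝓘(ℝ, ℝ) f p u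

/-- The exterior derivative of a 1-form,
`dη(X, Y) = ½ (X(η(Y)) - Y(η(X)) - η([X, Y]))`. The factor `½` is the normalization of `d` used
in contact metric geometry, for which the unit sphere is Sasakian. -/
def extDerivForm (η : ∀ q : N, TangentSpace (𝓡 m) q →L[ℝ] ℝ)
    (X Y : ∀ q : N, TangentSpace (𝓡 m) q) (p : N) : ℝ :=
  (1 / 2 : ℝ) * (dirDeriv (fun q => η q (Y q)) (X p) - dirDeriv (fun q => η q (X q)) (Y p)
    - η p (VectorField.mlieBracket (𝓡 m) X Y p))

/-- The Nijenhuis tensor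
`N_φ(X, Y) = [φX, φY] - φ[φX, Y] - φ[X, φY] + φ²[X, Y]`. -/
def nijenhuis (φ : ∀ q : N, TangentSpace (𝓡 m) q →L[ℝ] TangentSpace (𝓡 m) q)
    (X Y : ∀ q : N, TangentSpace (𝓡 m) q) (p : N) : TangentSpace (𝓡 m) p :=
  VectorField.mlieBracket (𝓡 m) (fun q => φ q (X q)) (fun q => φ q (Y q)) p
    - φ p (VectorField.mlieBracket (𝓡 m) (fun q => φ q (X q)) Y p)
    - φ p (VectorField.mlieBracket (𝓡 m) X (fun q => φ q (Y q)) p)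
    + φ p (φ p (VectorField.mlieBracket (𝓡 m) X Y p))

variable (m N) in
/-- A Sasakian structure `(φ, ξ, η, g)` on the `m`-dimensional manifold `N`: a contact metric
structure which is normal. -/
structure Structure where
  /-- the Riemannian metric -/
  g : Metric m N
  /-- the tensor field of type `(1, 1)` -/
  φ : ∀ q : N, TangentSpace (𝓡 m) q →L[ℝ] TangentSpace (𝓡 m) q
  /-- the characteristic vector field -/
  ξ : ∀ q : N, TangentSpace (𝓡 m) q
  /-- the contact form -/
  η : ∀ q : N, TangentSpace (𝓡 m) q →L[ℝ] ℝ
  smooth_φ : ContMDiff (𝓡 m)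
    ((𝓡 m).prod 𝓘(ℝ, EuclideanSpace ℝ (Fin m) →L[ℝ] EuclideanSpace ℝ (Fin m))) ∞
    (fun q => Bundle.TotalSpace.mk' (EuclideanSpace ℝ (Fin m) →L[ℝ] EuclideanSpace ℝ (Fin m))
      (E := fun q : N => TangentSpace (𝓡 m) q →L[ℝ] TangentSpace (𝓡 m) q) q (φ q))
  smooth_ξ : ContMDiff (𝓡 m) (𝓡 m).tangent ∞ (fun q => (⟨q, ξ q⟩ : TangentBundle (𝓡 m) N))
  smooth_η : ContMDiff (𝓡 m) ((𝓡 m).prod 𝓘(ℝ, EuclideanSpace ℝ (Fin m) →L[ℝ] ℝ)) ∞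
    (fun q => Bundle.TotalSpace.mk' (EuclideanSpace ℝ (Fin m) →L[ℝ] ℝ)
      (E := fun q : N => TangentSpace (𝓡 m) q →L[ℝ] Bundle.Trivial N ℝ q) q (η q))
  φ_sq : ∀ (p : N) (u : TangentSpace (𝓡 m) p), φ p (φ p u) = -u + η p u • ξ p
  η_ξ : ∀ p : N, η p (ξ p) = 1
  g_φ_φ : ∀ (p : N) (u v : TangentSpace (𝓡 m) p),
    g.inner p (φ p u) (φ p v) = g.inner p u v - η p u * η p v
  /-- the contact metric condition `g(X, φY) = dη(X, Y)` -/
  g_φ : ∀ (p : N) (X Y : ∀ q : N, TangentSpace (𝓡 m) q), SmoothFieldAt X p → SmoothFieldAt Y p →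
    g.inner p (X p) (φ p (Y p)) = extDerivForm η X Y p
  /-- normality, `N_φ + 2 dη ⊗ ξ = 0` -/
  normal : ∀ (p : N) (X Y : ∀ q : N, TangentSpace (𝓡 m) q), SmoothFieldAt X p → SmoothFieldAt Y p →
    nijenhuis φ X Y p + (2 * extDerivForm η X Y p) • ξ p = 0

/-- `N` has constant `φ`-sectional curvature `c` (it is a Sasakian space form `N(c)`): every plane
spanned by `u, φu`, with `u` a unit vector orthogonal to `ξ`, has sectional curvature
`g(R(u, φu)φu, u) = c`. -/
def Structure.IsSpaceForm (S : Structure m N) (c : ℝ) : Prop :=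
  ∀ (p : N) (u : TangentSpace (𝓡 m) p), S.g.inner p u u = 1 → S.g.inner p u (S.ξ p) = 0 →
    S.g.inner p (curvature S.g p u (S.φ p u) (S.φ p u)) u = c

/-- `γ` is, on `J`, an integral curve of the contact distribution: `η(γ') = 0`. -/
def Structure.IsLegendre (S : Structure m N) (J : Set ℝ) (γ : ℝ → N) : Prop :=
  ∀ t ∈ J, S.η (γ t) (velocity γ t) = 0

end Contact

end Sasaki

end

noncomputable section

set_option maxSynthPendingDepth 3

/-! Write A = 3(c-1)/4 and f = g(E₂, φT). The theorem rests on two computations. For horizontal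
orthogonal T, E₂ in a Sasakian space form, R(T, E₂)T = -(c+3)/4 E₂ - A f φT
(`Structure.IsSpaceForm.curvature_eq`). The Frenet equations expand ∇_T³T in the frame
(`IsFrenetCurve.covDeriv_covDeriv_tension_eq`). Together they give the bitension field in terms of
E₁, …, E₄ and φT (`IsFrenetCurve.bitension_eq`).

If r = 1 the curve is a geodesic. If r ≥ 2 then κ₁ > 0, and the components along T, E₂, E₃ read κ₁'
= 0, κ₁² + κ₂² = (c+3)/4 + A f², κ₂' = -A f g(E₃, φT). Since γ is Legendre, f' = κ₂ g(E₃, φT).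
Differentiating the second equation and using the third gives A f f' = 0, so f is a constant a,
which by assumption is not 0, 1 or -1. Hence κ₁ and κ₂ are constant, and what is left of the
equation can be solved for φT: it equals a E₂ + b E₄ with b = -κ₂κ₃/(A a). As |φT| = 1 and a² ≠ 1,
the field E₄ must exist and b ≠ 0; the relation a² + b² = 1 then makes κ₃ constant and gives the
angle. The converse is substitution. If c ≤ -3, the right-hand side of the equation for κ₁² + κ₂² is
at most 0, so r ≥ 2 is impossible for a biharmonic curve.

The curvature formula is derived from the definitions in charts. Contact condition and normality
give ∇ξ = -φ and (∇_uφ)v = g(u, v)ξ - η(v)u (`IsContactMetric.nabla_ξ_and_nabla_φ`). The Ricci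
identity turns these into formulas for R(u, v)ξ and for the commutator of R(u, v) with φ.
Subtracting from R the expected model tensor then leaves, on ker η, a form of Kähler type with zero
holomorphic sectional curvature; its sectional curvature vanishes
(`sectional_eq_zero_of_holomorphic_eq_zero`). -/

namespace Sasaki

/-! ### Kähler-type curvature forms. -/

section KaehlerAlgebra

variable {V : Type*} [AddCommGroup V]

/-- The pair symmetry of a curvature-like form. -/
theorem pair_symm_of_bianchi {V : Type*} (b : V → V → V → V → ℝ)
    (skew₁ : ∀ x y z w, b x y z w = -b y x z w)
    (skew₂ : ∀ x y z w, b x y z w = -b x y w z)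
    (bianchi : ∀ x y z w, b x y z w + b y z x w + b z x y w = 0) (x y z w : V) :
    b x y z w = b z w x y := by
  -- The octahedron argument: with one Bianchi identity for each choice of last argument, `h1 - h2 -
  -- h3 + h4` is, up to the skew symmetries, twice the difference of the two sides.
  have h1 := bianchi x y z w
  have h2 := bianchi y z w x
  have h3 := bianchi z w x y
  have h4 := bianchi w x y z
  have := skew₁ x y z w; have := skew₂ x y z w
  linarith [skew₁ y z x w, skew₂ y z x w, skew₁ z x y w, skew₂ z x y w, skew₁ y z w x,
    skew₂ z w y x, skew₁ z w y x, skew₁ w y z x, skew₂ w y z x, skew₁ z w x y, skew₂ w x z y,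
    skew₁ w x z y, skew₁ x z w y, skew₂ x z w y, skew₁ w x y z, skew₂ x y w z, skew₁ x y w z,
    skew₁ y w x z, skew₂ y w x z]

/-- A curvature-like form with the symmetries of a Kähler curvature tensor whose holomorphic
sectional curvature vanishes has vanishing sectional curvature. -/
theorem sectional_eq_zero_of_holomorphic_eq_zero (j : V → V) (b : V → V → V → V → ℝ)
    (hj : ∀ x, j (j x) = -x) (hj_add : ∀ x y, j (x + y) = j x + j y)
    (add₁ : ∀ x x' y z w, b (x + x') y z w = b x y z w + b x' y z w)
    (skew₁ : ∀ x y z w, b x y z w = -b y x z w)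
    (skew₂ : ∀ x y z w, b x y z w = -b x y w z)
    (bianchi : ∀ x y z w, b x y z w + b y z x w + b z x y w = 0)
    (kaehler : ∀ x y z w, b x y (j z) (j w) = b x y z w)
    (hol : ∀ x, b x (j x) (j x) x = 0) (x y : V) : b x y y x = 0 := by
  have pair := pair_symm_of_bianchi b skew₁ skew₂ bianchi
  have add₂ : ∀ x y y' z w, b x (y + y') z w = b x y z w + b x y' z w := by
    intro x y y' z w
    rw [skew₁, add₁, skew₁ x y, skew₁ x y']; ring
  have add₃ : ∀ x y z z' w, b x y (z + z') w = b x y z w + b x y z' w := by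
    intro x y z z' w
    rw [pair, add₁, pair z, pair z']
  have add₄ : ∀ x y z w w', b x y z (w + w') = b x y z w + b x y z w' := by
    intro x y z w w'
    rw [pair, add₂, pair _ w, pair _ w']
  have neg₁ : ∀ x y z w, b (-x) y z w = -b x y z w := fun x y z w =>
    (AddMonoidHom.mk' (fun x => b x y z w) (fun x x' => add₁ x x' y z w)).map_neg x
  have neg₂ : ∀ x y z w, b x (-y) z w = -b x y z w := by
    intro x y z w; rw [skew₁, neg₁, skew₁ x y]
  have neg₃ : ∀ x y z w, b x y (-z) w = -b x y z w := by
    intro x y z w; rw [pair, neg₁, pair z]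
  have neg₄ : ∀ x y z w, b x y z (-w) = -b x y z w := by
    intro x y z w; rw [pair, neg₂, pair _ w]
  have j_neg : ∀ x, j (-x) = -j x := fun x => (AddMonoidHom.mk' j hj_add).map_neg x
  have kaehler' : ∀ x y z w, b (j x) (j y) z w = b x y z w := by
    intro x y z w; rw [pair, kaehler, pair]
  -- Adding the vanishing holomorphic curvatures of `x + y` and `x - y` keeps only the terms
  -- quadratic in each vector. The Kähler symmetries and one Bianchi identity reduce those to `b x y
  -- y x` and `b x (j y) (j y) x`.
  have key : ∀ x y, b x y y x + 3 * b x (j y) (j y) x = 0 := by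
    intro x y
    have e1 := hol (x + y)
    have e2 := hol (x + -y)
    simp only [hj_add, j_neg, add₁, add₂, add₃, add₄, neg₁, neg₂, neg₃, neg₄, hol] at e1 e2
    have f1 : b x (j y) (j x) y = b x (j y) (j y) x := by
      rw [← kaehler, hj, neg₃, ← skew₂]
    have f2 : b y (j x) (j x) y = b x (j y) (j y) x := by
      rw [← kaehler', ← kaehler, hj, neg₂, neg₃, neg_neg, skew₁, skew₂, neg_neg]
    have f3 : b y (j x) (j y) x = b x (j y) (j y) x := by
      rw [← kaehler, hj, neg₃, ← skew₂, f2]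
    have f4 : b y (j y) (j x) x = b x (j x) (j y) y := by
      rw [pair, skew₁, skew₂, neg_neg]
    have f5 := bianchi x (j x) (j y) y
    rw [kaehler', skew₁ (j y) x, f1, skew₂ x y x y] at f5
    linarith
  -- Replacing `y` by `j y` exchanges the two unknowns, because `j (j y) = -y`; the system with
  -- coefficients (1, 3), (3, 1) is nonsingular.
  have h1 := key x y
  have h2 := key x (j y)
  rw [hj, neg₂, neg₃] at h2
  linarith

end KaehlerAlgebra

/-! ### Pointwise algebra of contact metric and Sasakian tensors. -/

section ContactAlgebra

variable {E : Type*} [NormedAddCommGroup E] [NormedSpace ℝ E]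

/-- The tensors of an almost contact metric structure at a point. -/
structure IsContactMetric (G : E →L[ℝ] E →L[ℝ] ℝ) (φ : E →L[ℝ] E) (ξ : E) (η : E →L[ℝ] ℝ) :
    Prop where
  symm : ∀ u v, G u v = G v u
  pos : ∀ u, u ≠ 0 → 0 < G u u
  sq : ∀ u, φ (φ u) = -u + η u • ξ
  η_ξ : η ξ = 1
  compat : ∀ u v, G (φ u) (φ v) = G u v - η u * η v

namespace IsContactMetric

variable {G : E →L[ℝ] E →L[ℝ] ℝ} {φ : E →L[ℝ] E} {ξ : E} {η : E →L[ℝ] ℝ}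
  (h : IsContactMetric G φ ξ η)
include h

theorem ext_inner {u v : E} (huv : ∀ w, G u w = G v w) : u = v := by
  by_contra hne
  have := h.pos (u - v) (sub_ne_zero.2 hne)
  rw [map_sub G, sub_apply, huv, sub_self] at this
  exact this.false

/-- From φ²ξ = 0, the vector φξ is a multiple λξ; applying φ once more gives λ² = 0. -/
theorem φ_ξ : φ ξ = 0 := by
  have h1 := h.sq ξ
  rw [h.η_ξ, one_smul, neg_add_cancel] at h1
  have h4 := h.sq (φ ξ)
  rw [h1, map_zero] at h4
  have h5 : φ ξ = η (φ ξ) • ξ := neg_add_eq_zero.1 h4.symm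
  have h6 : η (φ ξ) * η (φ ξ) = 0 := by
    have : φ (φ ξ) = η (φ ξ) • φ ξ := by conv_lhs => rw [h5, map_smul]
    rw [h1, h5, smul_smul] at this
    have h7 := congrArg η this
    rw [map_zero, map_smul, h.η_ξ, smul_eq_mul, mul_one, map_smul, h.η_ξ, smul_eq_mul, mul_one] at h7
    exact h7.symm
  rw [h5, mul_self_eq_zero.1 h6, zero_smul]

theorem inner_ξ (u : E) : G u ξ = η u := by
  have := h.compat u ξ
  rw [h.φ_ξ, map_zero, h.η_ξ] at this
  linarith

theorem η_φ (u : E) : η (φ u) = 0 := by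
  have h1 := h.sq (φ u)
  have h2 : φ (φ (φ u)) = -φ u := by
    rw [h.sq u, map_add, map_neg, map_smul, h.φ_ξ, smul_zero, add_zero]
  rw [h2] at h1
  have h3 := congrArg η h1
  rw [map_add, map_smul, h.η_ξ, smul_eq_mul, mul_one] at h3
  linarith

theorem φ_skew (u v : E) : G (φ u) v = -G u (φ v) := by
  have := h.compat u (φ v)
  rw [h.sq, map_add, map_neg, map_smul, h.η_φ, h.inner_ξ, h.η_φ] at this
  simp at this
  linarith

theorem inner_φ_self (u : E) : G u (φ u) = 0 := by
  have := h.φ_skew u u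
  rw [h.symm] at this
  linarith

/-- A normal contact metric structure satisfies the Sasakian identities; here this is linear algebra
at one point. `A u v` stands for (∇_uφ)v and `B u` for ∇_uξ. The hypotheses are the covariant
derivatives of the algebraic identities for φ, ξ, g, the closedness of the fundamental form, the
contact condition and normality. -/
theorem nabla_ξ_and_nabla_φ (A : E →ₗ[ℝ] E →ₗ[ℝ] E) (B : E →ₗ[ℝ] E)
    (A_skew : ∀ u v w, G (A u v) w = -G v (A u w))
    (closed : ∀ u v w, G (A u v) w + G (A v w) u + G (A w u) v = 0)
    (A_sq : ∀ u v, A u (φ v) + φ (A u v) = G (B u) v • ξ + η v • B u)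
    (A_ξ : ∀ u, A u ξ = -φ (B u))
    (B_ξ : ∀ u, η (B u) = 0)
    (B_alt : ∀ u v, G (B u) v - G (B v) u = 2 * G u (φ v))
    (normal : ∀ u v, A (φ u) v - A (φ v) u + φ (A v u) - φ (A u v) + (2 * G u (φ v)) • ξ = 0) :
    (∀ u, B u = -φ u) ∧ ∀ u v, A u v = G u v • ξ - η v • u := by
  have hB : ∀ u, B u = -φ u := by
    -- The contact condition says that the skew part of `B` is `-φ`, so `B + φ` is self-adjoint.
    have s_symm : ∀ u v, G (B u) v + G (φ u) v = G (B v) u + G (φ v) u := by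
      intro u v
      have := B_alt u v
      rw [h.φ_skew u v, h.φ_skew v u, h.symm v, h.φ_skew u v]
      linarith
    -- `a1` (closedness) and `n1` (normality) compute `A ξ` in two ways. Comparing them, `z1` shows
    -- that the form of `B + φ` vanishes on the image of φ, and `z2` extends this to all vectors
    -- since ξ is annihilated.
    have a1 : ∀ u v, G (A ξ u) v = G (B u) (φ v) - G (B v) (φ u) := by
      intro u v
      have h1 := closed ξ u v
      rw [A_ξ, A_skew u v ξ, A_ξ] at h1
      simp only [map_neg, neg_apply] at h1
      rw [h.φ_skew, h.symm v, h.φ_skew] at h1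
      linarith
    have Bξ : B ξ = 0 := by
      refine h.ext_inner fun w => ?_
      have := B_alt ξ w
      rw [h.inner_ξ, B_ξ, h.symm ξ, h.inner_ξ, h.η_φ] at this
      rw [map_zero, zero_apply]; linarith
    have n1 : ∀ u v, G (A ξ u) (φ v) = G (B (φ u)) (φ v) - G (B u) v := by
      intro u v
      have h1 := normal u ξ
      rw [h.φ_ξ, A_ξ, A_ξ, map_zero, map_zero, LinearMap.zero_apply, sub_zero, mul_zero,
        zero_smul, add_zero, map_neg, sub_neg_eq_add, h.sq, B_ξ, zero_smul, add_zero] at h1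
      have h2 := congrArg (fun z => G z v) h1
      simp only [map_add, map_neg, add_apply, neg_apply,
        map_zero, zero_apply] at h2
      rw [h.φ_skew, h.φ_skew] at h2
      linarith
    have z1 : ∀ u v, G (B (φ u)) (φ v) = -G (φ (φ u)) (φ v) := by
      intro u v
      have e1 := a1 u (φ v)
      have e2 := n1 u v
      have e3 := s_symm u v
      have e4 := s_symm (φ u) (φ v)
      rw [h.sq] at e1
      simp only [map_add, map_neg, map_smul, h.inner_ξ, B_ξ, smul_zero, add_zero] at e1
      have e5 := h.φ_skew u v
      have e6 := h.φ_skew v u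
      have e7 := h.compat (φ u) v
      have e8 := h.compat (φ v) u
      rw [h.η_φ] at e7 e8
      rw [h.symm v, e5] at e6
      linarith
    have z2 : ∀ u v, G (B u) v = -G (φ u) v := by
      intro u v
      have e := z1 (φ u) (φ v)
      have : ∀ w, φ (φ (φ w)) = -φ w := by
        intro w
        rw [h.sq w, map_add, map_neg, map_smul, h.φ_ξ, smul_zero, add_zero]
      rw [this] at e
      rw [h.sq, h.sq] at e
      simp only [map_add, map_neg, map_smul, h.inner_ξ, B_ξ, smul_zero, add_zero, Bξ, neg_neg,
        neg_apply, h.η_φ, neg_zero] at e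
      linarith
    intro u
    refine h.ext_inner fun w => ?_
    rw [z2, map_neg, neg_apply]
  refine ⟨hB, ?_⟩
  -- The defect of the claimed formula for ∇φ. It inherits skewness, the cyclic identity and
  -- normality without inhomogeneous terms, and has to be shown to vanish.
  let t : E → E → E → ℝ := fun u v w => G (A u v) w - G u v * η w + η v * G u w
  have t_skew : ∀ u v w, t u v w = -t u w v := by
    intro u v w
    simp only [t, A_skew u v w, h.symm v]; ring
  have t_cyc : ∀ u v w, t u v w + t v w u + t w u v = 0 := by
    intro u v w
    have := closed u v w
    simp only [t]
    rw [h.symm w u, h.symm v u, h.symm w v]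
    linarith
  have t_φ : ∀ u v w, t u (φ v) w = t u v (φ w) := by
    intro u v w
    have e := congrArg (fun z => G z w) (A_sq u v)
    simp only [map_add, map_smul, add_apply, smul_apply,
      smul_eq_mul, hB, map_neg, neg_apply, h.symm ξ, h.inner_ξ, h.φ_skew] at e
    simp only [t, h.η_φ]
    linarith
  have t_normal : ∀ u v w, t (φ u) v w - t (φ v) u w - t v u (φ w) + t u v (φ w) = 0 := by
    intro u v w
    have e := congrArg (fun z => G z w) (normal u v)
    simp only [map_add, map_sub, map_smul, add_apply,
      sub_apply, smul_apply, smul_eq_mul, h.symm ξ,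
      h.inner_ξ, h.φ_skew, map_zero, zero_apply] at e
    simp only [t, h.η_φ, h.φ_skew]
    rw [h.symm v (φ u), h.φ_skew, h.symm v u]
    linarith
  have t_cyc' : ∀ u v w, t (φ u) v w + t (φ v) w u = t (φ w) u v := by
    intro u v w
    have e1 := t_normal u v w
    have e2 := t_cyc u v (φ w)
    have e3 := t_skew v u (φ w)
    have e4 := t_skew (φ v) u w
    linarith
  -- For the three cyclic rotations `t_cyc'` reads a + b = c, b + c = a, c + a = b, which forces all
  -- three to vanish. What remains is the direction ξ, as u = -φ²u + η(u)ξ.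
  have t_zero : ∀ u v w, t (φ u) v w = 0 := by
    intro u v w
    have e1 := t_cyc' u v w
    have e2 := t_cyc' v w u
    have e3 := t_cyc' w u v
    linarith
  have t_ξ : ∀ v w, t ξ v w = 0 := by
    intro v w
    have e1 := t_cyc ξ v w
    have e2 : ∀ u v, t u ξ v = 0 := by
      intro u v
      simp only [t, A_ξ, hB, h.η_ξ, h.inner_ξ, map_neg, neg_neg, h.sq]
      simp [h.symm ξ, h.inner_ξ]
    rw [t_skew v w ξ, e2, e2] at e1
    linarith
  intro u v
  refine h.ext_inner fun w => ?_
  have e : t u v w = 0 := by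
    have e1 := t_zero (φ u) v w
    have e2 := t_ξ v w
    rw [h.sq] at e1
    simp only [t, map_add, map_neg, map_smul, LinearMap.add_apply, LinearMap.neg_apply,
      LinearMap.smul_apply, add_apply, neg_apply,
      smul_apply, smul_eq_mul] at e1 e2 ⊢
    linear_combination (-1) * e1 + η u * e2
  simp only [t] at e
  simp only [map_sub, map_smul, sub_apply, smul_apply,
    smul_eq_mul, h.symm ξ, h.inner_ξ]
  linarith

/-- The curvature of a Sasakian space form on horizontal vectors. -/
theorem curvature_of_sectional (R : E → E → E → E) (c : ℝ)
    (add₁ : ∀ x x' y z, R (x + x') y z = R x y z + R x' y z)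
    (skew₁ : ∀ x y z, R x y z = -R y x z)
    (skew₂ : ∀ x y z w, G (R x y z) w = -G (R x y w) z)
    (bianchi : ∀ x y z, R x y z + R y z x + R z x y = 0)
    (R_ξ : ∀ x y, R x y ξ = η y • x - η x • y)
    (R_φ : ∀ x y z, R x y (φ z) = φ (R x y z)
      + (-G y z • φ x + G x z • φ y - G z (φ y) • x + G z (φ x) • y))
    (sectional : ∀ x, η x = 0 → G (R x (φ x) (φ x)) x = c * (G x x) ^ 2)
    {x y : E} (hx : η x = 0) (hy : η y = 0) (hxx : G x x = 1) (hxy : G x y = 0) :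
    R x y x = -((c + 3) / 4) • y - (3 * (c - 1) / 4 * G y (φ x)) • φ x := by
  let K := LinearMap.ker (η : E →ₗ[ℝ] ℝ)
  -- The model is K₀ + (c-1)/4 (K₀ + K₁), with K₀ the constant curvature form and K₁ the φ-terms. K₀
  -- + K₁ is of Kähler type, and K₀ fails the Kähler identity by exactly the correction terms in
  -- `R_φ`; hence the difference `b` is of Kähler type on ker η.
  let b : K → K → K → K → ℝ :=
    fun x y z w => G (R x y z) w
      - ((c + 3) / 4 * (G (y : E) z * G (x : E) w - G (x : E) z * G (y : E) w)
        + (c - 1) / 4 * (G (z : E) (φ y) * G (φ x) (w : E) - G (z : E) (φ x) * G (φ y) (w : E)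
          + 2 * G (x : E) (φ y) * G (φ z) (w : E)))
  let j : K → K := fun x => ⟨φ x, h.η_φ x⟩
  have b_add : ∀ x x' y z w, b (x + x') y z w = b x y z w + b x' y z w := by
    intro x x' y z w
    simp only [b, Submodule.coe_add, add₁, map_add, add_apply]
    ring
  have b_skew₁ : ∀ x y z w, b x y z w = -b y x z w := by
    intro x y z w
    simp only [b]
    have e : G (y : E) (φ x) = -G (x : E) (φ y) := by rw [h.symm, h.φ_skew]
    rw [skew₁ y x, map_neg, neg_apply, e]
    ring
  have b_skew₂ : ∀ x y z w, b x y z w = -b x y w z := by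
    intro x y z w
    simp only [b]
    rw [skew₂ x y z w, h.symm (φ y) w, h.symm (φ x) w, h.symm (φ y) z, h.symm (φ x) z, h.φ_skew,
      h.symm (z : E) (φ w)]
    ring
  have b_bianchi : ∀ x y z w, b x y z w + b y z x w + b z x y w = 0 := by
    intro x y z w
    have e := congrArg (fun v => G v w) (bianchi x y z)
    simp only [map_add, add_apply, map_zero, zero_apply] at e
    simp only [b]
    have e1 : G (z : E) (φ y) = -G (y : E) (φ z) := by rw [h.symm, h.φ_skew]
    have e2 : G (x : E) (φ z) = -G (z : E) (φ x) := by rw [h.symm, h.φ_skew]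
    have e3 : G (y : E) (φ x) = -G (x : E) (φ y) := by rw [h.symm, h.φ_skew]
    rw [e1, e2, e3, h.symm (z : E) x, h.symm (y : E) x, h.symm (z : E) y]
    linear_combination e
  have b_kaehler : ∀ x y z w, b x y (j z) (j w) = b x y z w := by
    intro x y z w
    have e : ∀ u v : K, G (φ (u : E)) (φ (v : E)) = G (u : E) (v : E) := by
      intro u v
      rw [h.compat, show η (u : E) = 0 from u.2, zero_mul, sub_zero]
    have e' : ∀ u : K, φ (φ (u : E)) = -(u : E) := by
      intro u
      rw [h.sq, show η (u : E) = 0 from u.2, zero_smul, add_zero]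
    simp only [b, j, R_φ, map_add, map_sub, map_neg, map_smul, add_apply, sub_apply, smul_apply,
      neg_apply, smul_eq_mul, neg_smul]
    rw [h.compat, show η (w : E) = 0 from w.2, e', e, e, e, e]
    simp only [map_neg, neg_apply, h.φ_skew]
    have e1 : G (z : E) (φ y) = -G (y : E) (φ z) := by rw [h.symm, h.φ_skew]
    have e2 : G (z : E) (φ x) = -G (x : E) (φ z) := by rw [h.symm, h.φ_skew]
    rw [e1, e2, h.symm (z : E) x, h.symm (z : E) y]
    ring
  have b_hol : ∀ x, b x (j x) (j x) x = 0 := by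
    intro x
    simp only [b, j]
    rw [sectional x x.2, h.sq, show η (x : E) = 0 from x.2, h.compat, show η (x : E) = 0 from x.2, h.φ_skew]
    simp only [zero_smul, map_neg, neg_apply, h.inner_φ_self, add_zero]
    ring
  have j_j : ∀ x, j (j x) = -x := by
    intro x
    ext1
    change φ (φ x) = -(x : E)
    rw [h.sq, show η (x : E) = 0 from x.2, zero_smul, add_zero]
  have j_add : ∀ x y, j (x + y) = j x + j y := by
    intro x y
    ext1
    exact map_add φ _ _
  have b_zero := sectional_eq_zero_of_holomorphic_eq_zero j b j_j j_add b_add b_skew₁ b_skew₂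
    b_bianchi b_kaehler b_hol
  have b_pair := pair_symm_of_bianchi b b_skew₁ b_skew₂ b_bianchi
  -- Polarization: by pair symmetry `b x · x ·` is a symmetric bilinear form, and its quadratic form
  -- vanishes.
  have b_zero' : ∀ x y w, b x y x w = 0 := by
    intro x y w
    have e := b_zero x (y + w)
    rw [b_skew₁, b_add, b_skew₂, b_skew₂ w, b_skew₁ y, b_skew₁ w] at e
    have add₄ : ∀ z, b x z x (y + w) = b x z x y + b x z x w := by
      intro z
      rw [b_pair, b_skew₁, b_add, b_pair x z x y, b_pair x z x w, b_skew₁ x y, b_skew₁ x w]; ring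
    rw [add₄, add₄] at e
    have e1 := b_zero x y
    have e2 := b_zero x w
    rw [b_skew₂] at e1 e2
    have e3 := b_pair x y x w
    have e4 := b_skew₁ x y x y
    have e5 := b_skew₂ x y x y
    linarith
  -- `b` accepts only horizontal vectors, so it is tested on the horizontal part of `w`; the
  -- ξ-component of `R x y x` vanishes by `R_ξ`.
  refine h.ext_inner fun w => ?_
  have hw : η (w - η w • ξ) = 0 := by
    rw [map_sub, map_smul, h.η_ξ, smul_eq_mul, mul_one, sub_self]
  have e := b_zero' ⟨x, hx⟩ ⟨y, hy⟩ ⟨w - η w • ξ, hw⟩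
  have e' : η (R x y x) = 0 := by
    rw [← h.inner_ξ, skew₂, R_ξ, hx, hy]; simp
  simp only [b, map_sub, map_smul, h.inner_ξ, hx, hy, h.η_φ, smul_eq_mul, mul_zero, sub_zero, hxx,
    h.symm y x, hxy, e', h.inner_φ_self] at e
  simp only [map_sub, map_smul, map_neg, sub_apply, smul_apply, neg_apply, smul_eq_mul, neg_smul]
  have e3 : G x (φ y) = -G y (φ x) := by rw [h.symm, h.φ_skew]
  rw [e3] at e
  linear_combination e

end IsContactMetric

end ContactAlgebra

/-! ### Levi-Civita connection and curvature on an open set of a vector space. -/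

section Calculus

variable {E : Type*} [NormedAddCommGroup E] [NormedSpace ℝ E]

/-- The Christoffel symbols of the metric `G` on an open set of a vector space. -/
def christoffelOf (G : E → E →L[ℝ] E →L[ℝ] ℝ) (x u v : E) : E :=
  (G x).inverse
    ((1 / 2 : ℝ) • (fderiv ℝ G x u v + fderiv ℝ G x v u - ((fderiv ℝ G x).flip u).flip v))

/-- The curvature tensor of the metric `G` on an open set of a vector space. -/
def curvatureOf (G : E → E →L[ℝ] E →L[ℝ] ℝ) (x u v w : E) : E :=
  fderiv ℝ (fun y => christoffelOf G y v w) x u - fderiv ℝ (fun y => christoffelOf G y u w) x v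
    + christoffelOf G x u (christoffelOf G x v w) - christoffelOf G x v (christoffelOf G x u w)

/-- The Christoffel symbols as a bilinear map. -/
def christoffelMap (G : E → E →L[ℝ] E →L[ℝ] ℝ) (x : E) : E →L[ℝ] E →L[ℝ] E :=
  (ContinuousLinearMap.compL ℝ E (E →L[ℝ] ℝ) E (G x).inverse) ∘L
    ((1 / 2 : ℝ) • (fderiv ℝ G x + (fderiv ℝ G x).flip
      - (ContinuousLinearMap.flipₗᵢ ℝ E E ℝ : (E →L[ℝ] E →L[ℝ] ℝ) →L[ℝ] (E →L[ℝ] E →L[ℝ] ℝ)) ∘L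
        (fderiv ℝ G x).flip))

theorem christoffelMap_apply (G : E → E →L[ℝ] E →L[ℝ] ℝ) (x u v : E) :
    christoffelMap G x u v = christoffelOf G x u v := by
  simp [christoffelMap, christoffelOf]

/-- The covariant derivative of the vector field `W` in the direction `u`. -/
def nabla (G : E → E →L[ℝ] E →L[ℝ] ℝ) (W : E → E) (x u : E) : E :=
  fderiv ℝ W x u + christoffelMap G x u (W x)

/-- `G` is a smooth Riemannian metric on the open set `U`. -/
structure IsMetricOn (G : E → E →L[ℝ] E →L[ℝ] ℝ) (U : Set E) : Prop where
  isOpen : IsOpen U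
  smooth : ContDiffOn ℝ ∞ G U
  symm : ∀ x ∈ U, ∀ u v, G x u v = G x v u
  pos : ∀ x ∈ U, ∀ u, u ≠ 0 → 0 < G x u u

theorem fderiv_congr_on {F : Type*} [NormedAddCommGroup F] [NormedSpace ℝ F] {U : Set E}
    (hU : IsOpen U) {x : E} (hx : x ∈ U) {f g : E → F} (h : ∀ y ∈ U, f y = g y) :
    fderiv ℝ f x = fderiv ℝ g x :=
  Filter.EventuallyEq.fderiv_eq (Filter.eventually_of_mem (hU.mem_nhds hx) h)

theorem fderiv_clm_apply' {F F' : Type*} [NormedAddCommGroup F] [NormedSpace ℝ F]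
    [NormedAddCommGroup F'] [NormedSpace ℝ F'] {Φ : E → F →L[ℝ] F'} {a : E → F} {x : E}
    (hΦ : DifferentiableAt ℝ Φ x) (ha : DifferentiableAt ℝ a x) (u : E) :
    fderiv ℝ (fun y => Φ y (a y)) x u = fderiv ℝ Φ x u (a x) + Φ x (fderiv ℝ a x u) := by
  rw [fderiv_clm_apply hΦ ha]
  simp [add_comm]

theorem fderiv_clm_apply_const {F F' : Type*} [NormedAddCommGroup F] [NormedSpace ℝ F]
    [NormedAddCommGroup F'] [NormedSpace ℝ F'] {Φ : E → F →L[ℝ] F'} {x : E}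
    (hΦ : DifferentiableAt ℝ Φ x) (a : F) (u : E) :
    fderiv ℝ (fun y => Φ y a) x u = fderiv ℝ Φ x u a := by
  rw [fderiv_clm_apply' hΦ (differentiableAt_const a)]
  simp

theorem fderiv_fderiv_symm {F : Type*} [NormedAddCommGroup F] [NormedSpace ℝ F] {f : E → F}
    {x : E} (hf : ContDiffAt ℝ ∞ f x) (u v : E) :
    fderiv ℝ (fun y => fderiv ℝ f y v) x u = fderiv ℝ (fun y => fderiv ℝ f y u) x v := by
  have h1 : DifferentiableAt ℝ (fderiv ℝ f) x :=
    (hf.fderiv_right (m := ∞) le_rfl).differentiableAt (by simp)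
  rw [fderiv_clm_apply_const h1, fderiv_clm_apply_const h1]
  exact (hf.isSymmSndFDerivAt (by simpa using ENat.LEInfty.out)) u v

namespace IsMetricOn

variable {G : E → E →L[ℝ] E →L[ℝ] ℝ} {U : Set E} (h : IsMetricOn G U) {x : E} (hx : x ∈ U)
include h hx

theorem contDiffAt : ContDiffAt ℝ ∞ G x := h.smooth.contDiffAt (h.isOpen.mem_nhds hx)

theorem differentiableAt : DifferentiableAt ℝ G x :=
  (h.contDiffAt hx).differentiableAt (by simp)

theorem ext_inner {u v : E} (huv : ∀ w, G x u w = G x v w) : u = v := by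
  by_contra hne
  have := h.pos x hx (u - v) (sub_ne_zero.2 hne)
  rw [map_sub (G x), sub_apply, huv, sub_self] at this
  exact this.false

theorem fderiv_symm (u v w : E) : fderiv ℝ G x u v w = fderiv ℝ G x u w v := by
  have e : ∀ v w, fderiv ℝ G x u v w = fderiv ℝ (fun y => G y v w) x u := by
    intro v w
    rw [fderiv_clm_apply_const ((h.differentiableAt hx).clm_apply (differentiableAt_const v)),
      fderiv_clm_apply_const (h.differentiableAt hx)]
  rw [e, e, fderiv_congr_on h.isOpen hx (fun y hy => h.symm y hy v w)]

theorem christoffelMap_symm (u v : E) : christoffelMap G x u v = christoffelMap G x v u := by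
  rw [christoffelMap_apply, christoffelMap_apply, christoffelOf, christoffelOf]
  congr 2
  ext w
  simp [h.fderiv_symm hx w u v]
  ring

variable [FiniteDimensional ℝ E]

/-- `ContinuousLinearMap.inverse` takes the value 0 at a non-invertible map, so the Koszul formula
for the Christoffel symbols depends on this. Positivity gives injectivity, and finite dimension does
the rest. -/
theorem isInvertible : (G x).IsInvertible := by
  have hinj : Function.Injective ((G x : E →L[ℝ] E →L[ℝ] ℝ) : E →ₗ[ℝ] (E →L[ℝ] ℝ)) := by
    intro u v huv
    exact h.ext_inner hx fun w => by
      have := congrArg (fun f : E →L[ℝ] ℝ => f w) huv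
      exact this
  have hdim : Module.finrank ℝ E = Module.finrank ℝ (E →L[ℝ] ℝ) := by
    rw [← (LinearMap.toContinuousLinearMap (𝕜 := ℝ) (E := E) (F' := ℝ)).finrank_eq]
    exact (Subspace.dual_finrank_eq (K := ℝ) (V := E)).symm
  refine ⟨(LinearEquiv.ofInjectiveOfFinrankEq _ hinj hdim).toContinuousLinearEquiv, ?_⟩
  ext u w
  rfl

theorem inner_christoffelMap (u v w : E) : G x (christoffelMap G x u v) w
    = 1 / 2 * (fderiv ℝ G x u v w + fderiv ℝ G x v u w - fderiv ℝ G x w u v) := by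
  rw [christoffelMap_apply, christoffelOf]
  have := (h.isInvertible hx).self_apply_inverse
  rw [this]
  simp

/-- Metric compatibility ∇g = 0: in the sum of the two Koszul expressions all but the derivative
along `u` cancels. -/
theorem fderiv_eq_christoffelMap (u v w : E) : fderiv ℝ G x u v w
    = G x (christoffelMap G x u v) w + G x v (christoffelMap G x u w) := by
  rw [h.symm x hx v, h.inner_christoffelMap hx, h.inner_christoffelMap hx, h.fderiv_symm hx u w v]
  ring

theorem fderiv_inner {a b : E → E} (ha : DifferentiableAt ℝ a x) (hb : DifferentiableAt ℝ b x)
    (u : E) : fderiv ℝ (fun y => G y (a y) (b y)) x u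
      = G x (nabla G a x u) (b x) + G x (a x) (nabla G b x u) := by
  rw [fderiv_clm_apply' ((h.differentiableAt hx).clm_apply ha) hb,
    fderiv_clm_apply' (h.differentiableAt hx) ha, nabla, nabla, map_add (G x), map_add, add_apply,
    add_apply, h.fderiv_eq_christoffelMap hx]
  ring

theorem contDiffAt_christoffelMap : ContDiffAt ℝ ∞ (christoffelMap G) x := by
  have h1 : ContDiffAt ℝ ∞ (fderiv ℝ G) x := (h.contDiffAt hx).fderiv_right (m := ∞) le_rfl
  have h2 : ContDiffAt ℝ ∞ (fun y => (G y).inverse) x := by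
    obtain ⟨e, he⟩ := h.isInvertible hx
    have := contDiffAt_map_inverse (𝕜 := ℝ) (n := ∞) e
    rw [he] at this
    exact this.comp x (h.contDiffAt hx)
  have h3 : ContDiffAt ℝ ∞ (fun y => (fderiv ℝ G y).flip) x :=
    (ContinuousLinearMap.flipₗᵢ ℝ E E (E →L[ℝ] ℝ)).contDiff.contDiffAt.comp x h1
  unfold christoffelMap
  refine ContDiffAt.clm_comp ?_ ?_
  · exact (ContinuousLinearMap.contDiff _).contDiffAt.comp x h2
  · refine ContDiffAt.const_smul _ ((h1.add h3).sub ?_)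
    exact contDiffAt_const.clm_comp h3

theorem differentiableAt_christoffelMap : DifferentiableAt ℝ (christoffelMap G) x :=
  (h.contDiffAt_christoffelMap hx).differentiableAt (by simp)

theorem differentiableAt_nabla {W : E → E} (hW : ContDiffAt ℝ ∞ W x) (v : E) :
    DifferentiableAt ℝ (fun y => nabla G W y v) x := by
  unfold nabla
  have h1 : DifferentiableAt ℝ (fderiv ℝ W) x :=
    (hW.fderiv_right (m := ∞) le_rfl).differentiableAt (by simp)
  exact (h1.clm_apply (differentiableAt_const v)).add
    (((h.differentiableAt_christoffelMap hx).clm_apply (differentiableAt_const v)).clm_apply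
      (hW.differentiableAt (by simp)))

theorem curvatureOf_eq (u v w : E) : curvatureOf G x u v w =
    fderiv ℝ (christoffelMap G) x u v w - fderiv ℝ (christoffelMap G) x v u w
    + christoffelMap G x u (christoffelMap G x v w)
    - christoffelMap G x v (christoffelMap G x u w) := by
  have e : ∀ u v, fderiv ℝ (fun y => christoffelOf G y v w) x u
      = fderiv ℝ (christoffelMap G) x u v w := by
    intro u v
    simp_rw [← christoffelMap_apply]
    rw [fderiv_clm_apply_const
      ((h.differentiableAt_christoffelMap hx).clm_apply (differentiableAt_const v)),
      fderiv_clm_apply_const (h.differentiableAt_christoffelMap hx)]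
  rw [curvatureOf, e, e]
  simp_rw [← christoffelMap_apply]

/-- The Ricci identity for coordinate directions. -/
theorem nabla_nabla_sub {W : E → E} (hW : ContDiffAt ℝ ∞ W x) (u v : E) :
    nabla G (fun y => nabla G W y v) x u - nabla G (fun y => nabla G W y u) x v
      = curvatureOf G x u v (W x) := by
  have h1 : DifferentiableAt ℝ (fderiv ℝ W) x :=
    (hW.fderiv_right (m := ∞) le_rfl).differentiableAt (by simp)
  have h0 : DifferentiableAt ℝ W x := hW.differentiableAt (by simp)
  have h2 := h.differentiableAt_christoffelMap hx
  have e : ∀ u v, nabla G (fun y => nabla G W y v) x u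
      = fderiv ℝ (fun y => fderiv ℝ W y v) x u + fderiv ℝ (christoffelMap G) x u v (W x)
        + christoffelMap G x v (fderiv ℝ W x u) + christoffelMap G x u (fderiv ℝ W x v)
        + christoffelMap G x u (christoffelMap G x v (W x)) := by
    intro u v
    have hd : DifferentiableAt ℝ (fun y => christoffelMap G y v) x :=
      h2.clm_apply (differentiableAt_const v)
    unfold nabla
    rw [fderiv_fun_add (h1.clm_apply (differentiableAt_const v)) (hd.clm_apply h0), add_apply,
      fderiv_clm_apply' hd h0, fderiv_clm_apply_const h2, map_add]
    abel
  rw [e, e, fderiv_fderiv_symm hW u v, h.curvatureOf_eq hx]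
  abel

theorem curvatureOf_skew (u v w : E) : curvatureOf G x u v w = -curvatureOf G x v u w := by
  rw [h.curvatureOf_eq hx, h.curvatureOf_eq hx]
  abel

theorem curvatureOf_add (u u' v w : E) :
    curvatureOf G x (u + u') v w = curvatureOf G x u v w + curvatureOf G x u' v w := by
  simp only [h.curvatureOf_eq hx, map_add, add_apply]
  abel

theorem curvatureOf_smul₁ (a : ℝ) (u v w : E) :
    curvatureOf G x (a • u) v w = a • curvatureOf G x u v w := by
  simp only [h.curvatureOf_eq hx, map_smul, smul_apply, smul_add, smul_sub]

theorem curvatureOf_smul₂ (a : ℝ) (u v w : E) :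
    curvatureOf G x u (a • v) w = a • curvatureOf G x u v w := by
  simp only [h.curvatureOf_eq hx, map_smul, smul_apply, smul_add, smul_sub]

theorem curvatureOf_smul₃ (a : ℝ) (u v w : E) :
    curvatureOf G x u v (a • w) = a • curvatureOf G x u v w := by
  simp only [h.curvatureOf_eq hx, map_smul, smul_add, smul_sub]

theorem curvatureOf_bianchi (u v w : E) :
    curvatureOf G x u v w + curvatureOf G x v w u + curvatureOf G x w u v = 0 := by
  have e : ∀ u v w, fderiv ℝ (christoffelMap G) x u v w
      = fderiv ℝ (christoffelMap G) x u w v := by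
    intro u v w
    have e : ∀ v w, fderiv ℝ (christoffelMap G) x u v w
        = fderiv ℝ (fun y => christoffelMap G y v w) x u := by
      intro v w
      rw [fderiv_clm_apply_const
        ((h.differentiableAt_christoffelMap hx).clm_apply (differentiableAt_const v)),
        fderiv_clm_apply_const (h.differentiableAt_christoffelMap hx)]
    rw [e, e, fderiv_congr_on h.isOpen hx (fun y hy => h.christoffelMap_symm hy v w)]
  rw [h.curvatureOf_eq hx, h.curvatureOf_eq hx, h.curvatureOf_eq hx, e u v w, e v w u, e w u v,
    h.christoffelMap_symm hx u v, h.christoffelMap_symm hx v w, h.christoffelMap_symm hx w u]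
  abel

/-- Second derivatives of the function g(w, z), with `w` and `z` constant fields, commute. Expanding
both orders by metric compatibility, the mixed products cancel and the Ricci identity leaves the
curvature terms. -/
theorem inner_curvatureOf_skew (u v w z : E) :
    G x (curvatureOf G x u v w) z = -G x (curvatureOf G x u v z) w := by
  have hc : ∀ w : E, DifferentiableAt ℝ (fun _ : E => w) x := fun w => differentiableAt_const w
  have e1 : ∀ u v, fderiv ℝ (fun y => fderiv ℝ (fun y => G y w z) y v) x u
      = G x (nabla G (fun y => nabla G (fun _ => w) y v) x u) z
        + G x (nabla G (fun _ => w) x v) (nabla G (fun _ => z) x u)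
        + (G x (nabla G (fun _ => w) x u) (nabla G (fun _ => z) x v)
          + G x w (nabla G (fun y => nabla G (fun _ => z) y v) x u)) := by
    intro u v
    rw [fderiv_congr_on h.isOpen hx (fun y hy => h.fderiv_inner hy (differentiableAt_const w)
      (differentiableAt_const z) v)]
    have d : ∀ w : E, DifferentiableAt ℝ (fun y => nabla G (fun _ => w) y v) x :=
      fun w => h.differentiableAt_nabla hx contDiffAt_const v
    rw [fderiv_fun_add (((h.differentiableAt hx).clm_apply (d w)).clm_apply (hc z))
      (((h.differentiableAt hx).clm_apply (hc w)).clm_apply (d z)), add_apply,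
      h.fderiv_inner hx (d w) (hc z), h.fderiv_inner hx (hc w) (d z)]
  have e2 : ContDiffAt ℝ ∞ (fun y => G y w z) x :=
    ((h.contDiffAt hx).clm_apply contDiffAt_const).clm_apply contDiffAt_const
  have e3 := fderiv_fderiv_symm e2 u v
  rw [e1, e1] at e3
  rw [← h.nabla_nabla_sub hx (W := fun _ => w) contDiffAt_const,
    ← h.nabla_nabla_sub hx (W := fun _ => z) contDiffAt_const, map_sub, map_sub, sub_apply,
    sub_apply, h.symm x hx _ w, h.symm x hx _ w]
  linarith

end IsMetricOn

end Calculus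

/-! ### Sasakian identities and curvature on an open set of a vector space. -/

section SasakianCalculus

variable {E : Type*} [NormedAddCommGroup E] [NormedSpace ℝ E]

section Nabla

theorem nabla_congr {G : E → E →L[ℝ] E →L[ℝ] ℝ} {U : Set E} (hU : IsOpen U) {x : E}
    (hx : x ∈ U) {a b : E → E} (hab : ∀ y ∈ U, a y = b y) (u : E) :
    nabla G a x u = nabla G b x u := by
  rw [nabla, nabla, fderiv_congr_on hU hx hab, hab x hx]

variable {G : E → E →L[ℝ] E →L[ℝ] ℝ} {x : E}

theorem nabla_const (v u : E) : nabla G (fun _ => v) x u = christoffelMap G x u v := by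
  simp [nabla]

theorem nabla_smul {f : E → ℝ} {a : E → E} (hf : DifferentiableAt ℝ f x)
    (ha : DifferentiableAt ℝ a x) (u : E) :
    nabla G (fun y => f y • a y) x u = fderiv ℝ f x u • a x + f x • nabla G a x u := by
  rw [nabla, fderiv_fun_smul hf ha, nabla]
  simp only [add_apply, smul_apply, ContinuousLinearMap.smulRight_apply, map_smul, smul_add]
  abel

theorem nabla_add {a b : E → E} (ha : DifferentiableAt ℝ a x)
    (hb : DifferentiableAt ℝ b x) (u : E) :
    nabla G (fun y => a y + b y) x u = nabla G a x u + nabla G b x u := by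
  rw [nabla, fderiv_fun_add ha hb, nabla, nabla]
  simp only [add_apply, map_add]
  abel

theorem nabla_sub {a b : E → E} (ha : DifferentiableAt ℝ a x)
    (hb : DifferentiableAt ℝ b x) (u : E) :
    nabla G (fun y => a y - b y) x u = nabla G a x u - nabla G b x u := by
  rw [nabla, fderiv_fun_sub ha hb, nabla, nabla]
  simp only [sub_apply, map_sub]
  abel

end Nabla

/-- The covariant derivative `(∇_u Φ) v` of a field of endomorphisms. -/
def nablaEnd (G : E → E →L[ℝ] E →L[ℝ] ℝ) (Φ : E → E →L[ℝ] E) (x : E) : E →ₗ[ℝ] E →ₗ[ℝ] E :=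
  LinearMap.mk₂ ℝ (fun u v => fderiv ℝ Φ x u v + christoffelMap G x u (Φ x v)
      - Φ x (christoffelMap G x u v))
    (fun u u' v => by simp only [map_add, add_apply]; abel)
    (fun a u v => by simp only [map_smul, smul_apply, smul_add, smul_sub])
    (fun u v v' => by simp only [map_add]; abel)
    (fun a u v => by simp only [map_smul, smul_add, smul_sub])

/-- `(Φ, Ξ, H, G)` is a Sasakian structure on the open set `U` of a vector space. The contact
condition and normality are expressed with constant vector fields. -/
structure IsSasakianOn (G : E → E →L[ℝ] E →L[ℝ] ℝ) (Φ : E → E →L[ℝ] E) (Ξ : E → E)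
    (H : E → E →L[ℝ] ℝ) (U : Set E) : Prop extends IsMetricOn G U where
  smooth_φ : ContDiffOn ℝ ∞ Φ U
  smooth_ξ : ContDiffOn ℝ ∞ Ξ U
  smooth_η : ContDiffOn ℝ ∞ H U
  contact : ∀ x ∈ U, IsContactMetric (G x) (Φ x) (Ξ x) (H x)
  inner_φ : ∀ x ∈ U, ∀ u v, G x u (Φ x v) = 1 / 2 * (fderiv ℝ H x u v - fderiv ℝ H x v u)
  normal : ∀ x ∈ U, ∀ u v, fderiv ℝ Φ x (Φ x u) v - fderiv ℝ Φ x (Φ x v) u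
    + Φ x (fderiv ℝ Φ x v u) - Φ x (fderiv ℝ Φ x u v) + (2 * G x u (Φ x v)) • Ξ x = 0

namespace IsSasakianOn

variable {G : E → E →L[ℝ] E →L[ℝ] ℝ} {Φ : E → E →L[ℝ] E} {Ξ : E → E} {H : E → E →L[ℝ] ℝ}
  {U : Set E} (h : IsSasakianOn G Φ Ξ H U) {x : E} (hx : x ∈ U)
include h hx

theorem contDiffAt_φ : ContDiffAt ℝ ∞ Φ x := h.smooth_φ.contDiffAt (h.isOpen.mem_nhds hx)

theorem contDiffAt_ξ : ContDiffAt ℝ ∞ Ξ x := h.smooth_ξ.contDiffAt (h.isOpen.mem_nhds hx)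

theorem contDiffAt_η : ContDiffAt ℝ ∞ H x := h.smooth_η.contDiffAt (h.isOpen.mem_nhds hx)

theorem differentiableAt_φ : DifferentiableAt ℝ Φ x :=
  (h.contDiffAt_φ hx).differentiableAt (by simp)

theorem differentiableAt_ξ : DifferentiableAt ℝ Ξ x :=
  (h.contDiffAt_ξ hx).differentiableAt (by simp)

theorem differentiableAt_η : DifferentiableAt ℝ H x :=
  (h.contDiffAt_η hx).differentiableAt (by simp)

theorem nabla_apply_φ {a : E → E} (ha : DifferentiableAt ℝ a x) (u : E) :
    nabla G (fun y => Φ y (a y)) x u = nablaEnd G Φ x u (a x) + Φ x (nabla G a x u) := by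
  simp only [nabla, nablaEnd, LinearMap.mk₂_apply, fderiv_clm_apply' (h.differentiableAt_φ hx) ha,
    map_add]
  abel

variable [FiniteDimensional ℝ E]

theorem nablaEnd_skew (u v w : E) :
    G x (nablaEnd G Φ x u v) w = -G x v (nablaEnd G Φ x u w) := by
  have hc : ∀ w : E, DifferentiableAt ℝ (fun _ : E => w) x := fun w => differentiableAt_const w
  have hφ : ∀ w : E, DifferentiableAt ℝ (fun y => Φ y w) x :=
    fun w => (h.differentiableAt_φ hx).clm_apply (hc w)
  have e : fderiv ℝ (fun y => G y (Φ y v) w) x u = fderiv ℝ (fun y => -G y v (Φ y w)) x u := by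
    rw [fderiv_congr_on h.isOpen hx (fun y hy => (h.contact y hy).φ_skew v w)]
  rw [fderiv_fun_neg, neg_apply, h.fderiv_inner hx (hφ v) (hc w), h.fderiv_inner hx (hc v) (hφ w),
    h.nabla_apply_φ hx (hc v), h.nabla_apply_φ hx (hc w)] at e
  simp only [map_add, add_apply, (h.contact x hx).φ_skew] at e
  linarith

/-- The fundamental form g(u, φv) equals dη, hence is closed: in the cyclic sum the second
derivatives of η cancel by symmetry, and the Christoffel terms cancel because the connection is
torsion-free. -/
theorem nablaEnd_cyclic (u v w : E) : G x (nablaEnd G Φ x u v) w + G x (nablaEnd G Φ x v w) u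
    + G x (nablaEnd G Φ x w u) v = 0 := by
  have hc : ∀ w : E, DifferentiableAt ℝ (fun _ : E => w) x := fun w => differentiableAt_const w
  have hφ : ∀ w : E, DifferentiableAt ℝ (fun y => Φ y w) x :=
    fun w => (h.differentiableAt_φ hx).clm_apply (hc w)
  have hH : ∀ u v : E, DifferentiableAt ℝ (fun y => fderiv ℝ H y u v) x := fun u v =>
    ((((h.contDiffAt_η hx).fderiv_right (m := ∞) le_rfl).differentiableAt (by simp)).clm_apply
      (hc u)).clm_apply (hc v)
  have hHv : ∀ v y, y ∈ U → ∀ u, fderiv ℝ H y u v = fderiv ℝ (fun y => H y v) y u :=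
    fun v y hy u => (fderiv_clm_apply_const (h.differentiableAt_η hy) v u).symm
  have e1 : ∀ u v w, G x v (nablaEnd G Φ x u w)
      + (G x (christoffelMap G x u v) (Φ x w) - G x (Φ x v) (christoffelMap G x u w))
      = 1 / 2 * (fderiv ℝ (fun y => fderiv ℝ H y v w) x u
        - fderiv ℝ (fun y => fderiv ℝ H y w v) x u) := by
    intro u v w
    have e : fderiv ℝ (fun y => G y v (Φ y w)) x u
        = fderiv ℝ (fun y => 1 / 2 * (fderiv ℝ H y v w - fderiv ℝ H y w v)) x u := by
      rw [fderiv_congr_on h.isOpen hx (fun y hy => h.inner_φ y hy v w)]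
    rw [fderiv_const_mul ((hH v w).fun_sub (hH w v)), smul_apply, fderiv_fun_sub (hH v w) (hH w v),
      sub_apply, h.fderiv_inner hx (hc v) (hφ w), h.nabla_apply_φ hx (hc w), map_add, nabla_const, nabla_const,
      smul_eq_mul] at e
    rw [← e, (h.contact x hx).φ_skew]
    ring
  have e2 : ∀ u v w, fderiv ℝ (fun y => fderiv ℝ H y v w) x u
      = fderiv ℝ (fun y => fderiv ℝ H y u w) x v := by
    intro u v w
    rw [fderiv_congr_on h.isOpen hx (fun y hy => hHv w y hy v),
      fderiv_congr_on h.isOpen hx (fun y hy => hHv w y hy u),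
      fderiv_fderiv_symm ((h.contDiffAt_η hx).clm_apply contDiffAt_const)]
  have f1 := e1 u v w
  have f2 := e1 v w u
  have f3 := e1 w u v
  rw [e2 u v w] at f1
  rw [e2 v w u] at f2
  rw [e2 w u v] at f3
  rw [h.nablaEnd_skew hx, h.nablaEnd_skew hx, h.nablaEnd_skew hx]
  have s := h.symm x hx
  rw [s (Φ x v), h.christoffelMap_symm hx u w] at f1
  rw [s (Φ x w), h.christoffelMap_symm hx v u] at f2
  rw [s (Φ x u), h.christoffelMap_symm hx w v] at f3
  linarith

theorem nabla_ξ_and_nablaEnd : (∀ u, nabla G Ξ x u = -Φ x u) ∧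
    ∀ u v, nablaEnd G Φ x u v = G x u v • Ξ x - H x v • u := by
  have hc : ∀ w : E, DifferentiableAt ℝ (fun _ : E => w) x := fun w => differentiableAt_const w
  have hφ : ∀ w : E, DifferentiableAt ℝ (fun y => Φ y w) x :=
    fun w => (h.differentiableAt_φ hx).clm_apply (hc w)
  have hξ := h.differentiableAt_ξ hx
  have hη := h.differentiableAt_η hx
  let B : E →ₗ[ℝ] E := fderiv ℝ Ξ x + (christoffelMap G x).flip (Ξ x)
  have hB : ∀ u, B u = nabla G Ξ x u := fun u => rfl
  have hdη : ∀ u v, fderiv ℝ H x u v - H x (christoffelMap G x u v) = G x (B u) v := by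
    intro u v
    have e : fderiv ℝ (fun y => H y v) x u = fderiv ℝ (fun y => G y v (Ξ y)) x u := by
      rw [fderiv_congr_on h.isOpen hx (fun y hy => ((h.contact y hy).inner_ξ v).symm)]
    rw [fderiv_clm_apply_const hη, h.fderiv_inner hx (hc v) hξ, (h.contact x hx).inner_ξ, ← hB,
      nabla_const] at e
    rw [e, h.symm x hx v]
    ring
  -- The five remaining hypotheses come, in this order, from differentiating φ² = -I + η⊗ξ, φξ = 0
  -- and g(ξ, ξ) = 1, from the contact condition, and from normality, where torsion-freeness lets ∇φ
  -- replace the partial derivatives of φ.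
  have main := (h.contact x hx).nabla_ξ_and_nabla_φ (nablaEnd G Φ x) B (h.nablaEnd_skew hx)
    (h.nablaEnd_cyclic hx) ?_ ?_ ?_ ?_ ?_
  · exact main
  · intro u v
    have e : nabla G (fun y => Φ y (Φ y v)) x u = nabla G (fun y => -v + H y v • Ξ y) x u := by
      simp only [nabla]
      rw [fderiv_congr_on h.isOpen hx (fun y hy => (h.contact y hy).sq v), (h.contact x hx).sq]
    rw [h.nabla_apply_φ hx (hφ v), h.nabla_apply_φ hx (hc v), map_add, (h.contact x hx).sq] at e
    simp only [nabla, fderiv_fun_const, Pi.zero_apply, zero_apply, zero_add] at e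
    rw [fderiv_const_add, fderiv_fun_smul (hη.clm_apply (hc v)) hξ] at e
    simp only [add_apply, smul_apply, ContinuousLinearMap.smulRight_apply, map_add, map_neg,
      map_smul, fderiv_clm_apply_const hη] at e
    rw [← hdη, sub_smul, hB, nabla, smul_add]
    have e' : nablaEnd G Φ x u (Φ x v) + Φ x (nablaEnd G Φ x u v)
      = (nablaEnd G Φ x u (Φ x v) + (Φ x (nablaEnd G Φ x u v) +
        (-christoffelMap G x u v + H x (christoffelMap G x u v) • Ξ x)))
        + (christoffelMap G x u v - H x (christoffelMap G x u v) • Ξ x) := by abel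
    rw [e', e]
    abel
  · intro u
    have e : nabla G (fun y => Φ y (Ξ y)) x u = nabla G (fun _ => 0) x u := by
      simp only [nabla]
      rw [fderiv_congr_on h.isOpen hx (fun y hy => (h.contact y hy).φ_ξ), (h.contact x hx).φ_ξ]
    rw [h.nabla_apply_φ hx hξ, ← hB] at e
    simp only [nabla, fderiv_fun_const, Pi.zero_apply, zero_apply, map_zero, add_zero] at e
    exact eq_neg_of_add_eq_zero_left e
  · intro u
    have e : fderiv ℝ (fun y => G y (Ξ y) (Ξ y)) x u = fderiv ℝ (fun _ => (1 : ℝ)) x u := by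
      rw [fderiv_congr_on h.isOpen hx (fun y hy => by
        rw [(h.contact y hy).inner_ξ, (h.contact y hy).η_ξ])]
    rw [h.fderiv_inner hx hξ hξ, h.symm x hx (Ξ x), (h.contact x hx).inner_ξ, ← hB,
      fderiv_fun_const, Pi.zero_apply, zero_apply] at e
    linarith
  · intro u v
    rw [← hdη, ← hdη, h.inner_φ x hx, h.christoffelMap_symm hx v u]
    ring
  · intro u v
    rw [← h.normal x hx u v]
    simp only [nablaEnd, LinearMap.mk₂_apply, map_add, map_sub]
    rw [h.christoffelMap_symm hx (Φ x v) (Φ x u), h.christoffelMap_symm hx (Φ x v) u,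
      h.christoffelMap_symm hx (Φ x u) v, h.christoffelMap_symm hx v u]
    abel

theorem nabla_ξ (u : E) : nabla G Ξ x u = -Φ x u := (h.nabla_ξ_and_nablaEnd hx).1 u

theorem nablaEnd_eq (u v : E) : nablaEnd G Φ x u v = G x u v • Ξ x - H x v • u :=
  (h.nabla_ξ_and_nablaEnd hx).2 u v

/-- The Ricci identity for ξ: the second derivative of ξ is minus the derivative of φ, and its part
symmetric in `u`, `v` drops out. -/
theorem curvatureOf_ξ (u v : E) : curvatureOf G x u v (Ξ x) = H x v • u - H x u • v := by
  rw [← h.nabla_nabla_sub hx (h.contDiffAt_ξ hx)]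
  have e : ∀ u v, nabla G (fun y => nabla G Ξ y v) x u
      = -(G x u v • Ξ x - H x v • u) - Φ x (christoffelMap G x u v) := by
    intro u v
    have hφ := (h.differentiableAt_φ hx).clm_apply (differentiableAt_const v)
    have e1 : nabla G (fun y => nabla G Ξ y v) x u = nabla G (fun y => 0 - Φ y v) x u :=
      nabla_congr h.isOpen hx (fun y hy => by rw [h.nabla_ξ hy, zero_sub]) u
    rw [e1, nabla_sub (differentiableAt_const 0) hφ, h.nabla_apply_φ hx
      (differentiableAt_const v), nabla_const, nabla_const, h.nablaEnd_eq hx, map_zero]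
    abel
  rw [e, e, h.symm x hx v u, h.christoffelMap_symm hx v u]
  abel

/-- The Ricci identity for the field φw with `w` constant. All terms of the second derivative that
are symmetric in `u`, `v` drop out; the derivatives of ξ and η in the formula for ∇φ produce the
correction. -/
theorem curvatureOf_φ (u v w : E) : curvatureOf G x u v (Φ x w) = Φ x (curvatureOf G x u v w)
    + (-G x v w • Φ x u + G x u w • Φ x v - G x w (Φ x v) • u + G x w (Φ x u) • v) := by
  have hc : ∀ w : E, DifferentiableAt ℝ (fun _ : E => w) x := fun w => differentiableAt_const w
  have hs : ContDiffAt ℝ ∞ (fun y => Φ y w) x := (h.contDiffAt_φ hx).clm_apply contDiffAt_const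
  have hξ := h.differentiableAt_ξ hx
  rw [← h.nabla_nabla_sub hx hs, ← h.nabla_nabla_sub hx (W := fun _ => w) contDiffAt_const]
  have e : ∀ u v, nabla G (fun y => nabla G (fun y => Φ y w) y v) x u
      = (G x (christoffelMap G x u v) w + G x v (christoffelMap G x u w)
          + G x u (christoffelMap G x v w)) • Ξ x - G x v w • Φ x u
        - (H x (christoffelMap G x v w) • u + H x (christoffelMap G x u w) • v
          + H x w • christoffelMap G x u v) + G x w (Φ x u) • v
        + Φ x (nabla G (fun y => nabla G (fun _ => w) y v) x u) := by
    intro u v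
    -- Here η(w) is written as g(w, ξ), so that its derivative follows from metric compatibility and
    -- ∇ξ = -φ.
    have e1 : nabla G (fun y => nabla G (fun y => Φ y w) y v) x u
        = nabla G (fun y => G y v w • Ξ y - G y w (Ξ y) • v
          + Φ y (nabla G (fun _ => w) y v)) x u :=
      nabla_congr h.isOpen hx (fun y hy => by
        rw [h.nabla_apply_φ hy (differentiableAt_const w), h.nablaEnd_eq hy,
          (h.contact y hy).inner_ξ]) u
    have d1 : DifferentiableAt ℝ (fun y => G y v w) x :=
      ((h.differentiableAt hx).clm_apply (hc v)).clm_apply (hc w)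
    have d2 : DifferentiableAt ℝ (fun y => G y w (Ξ y)) x :=
      ((h.differentiableAt hx).clm_apply (hc w)).clm_apply hξ
    have d3 : DifferentiableAt ℝ (fun y => nabla G (fun _ => w) y v) x :=
      h.differentiableAt_nabla hx contDiffAt_const v
    have d4 := (h.differentiableAt_φ hx).clm_apply d3
    rw [e1, nabla_add ((d1.fun_smul hξ).fun_sub (d2.fun_smul (hc v))) d4,
      nabla_sub (d1.fun_smul hξ) (d2.fun_smul (hc v)), nabla_smul d1 hξ,
      nabla_smul d2 (hc v), h.nabla_apply_φ hx d3, h.nablaEnd_eq hx,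
      h.fderiv_inner hx (hc v) (hc w), h.fderiv_inner hx (hc w) hξ, h.nabla_ξ hx,
      nabla_const, nabla_const, nabla_const, (h.contact x hx).inner_ξ,
      (h.contact x hx).inner_ξ, map_neg]
    simp only [smul_neg, add_smul, neg_smul]
    abel
  rw [e, e, map_sub, h.christoffelMap_symm hx v u]
  have : G x (christoffelMap G x u v) w + G x v (christoffelMap G x u w)
      + G x u (christoffelMap G x v w) = G x (christoffelMap G x u v) w
      + G x u (christoffelMap G x v w) + G x v (christoffelMap G x u w) := by ring
  rw [this]
  simp only [neg_smul]
  abel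

/-- The curvature of a Sasakian space form on horizontal vectors, in coordinates. -/
theorem curvatureOf_of_sectional (c : ℝ) (sectional : ∀ u, G x u u = 1 → G x u (Ξ x) = 0 →
      G x (curvatureOf G x u (Φ x u) (Φ x u)) u = c) {u v : E} (hu : H x u = 0) (hv : H x v = 0)
    (huu : G x u u = 1) (huv : G x u v = 0) :
    curvatureOf G x u v u
      = -((c + 3) / 4) • v - (3 * (c - 1) / 4 * G x v (Φ x u)) • Φ x u := by
  refine (h.contact x hx).curvature_of_sectional (curvatureOf G x) c (h.curvatureOf_add hx)
    (h.curvatureOf_skew hx) (h.inner_curvatureOf_skew hx) (h.curvatureOf_bianchi hx)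
    (h.curvatureOf_ξ hx) (h.curvatureOf_φ hx) ?_ hu hv huu huv
  intro w hw
  by_cases hw0 : w = 0
  · subst hw0; simp
  have hpos := h.pos x hx w hw0
  -- Normalizing `w` to unit length: the curvature expression is homogeneous of degree four, whence
  -- the square of `G x w w`.
  obtain ⟨s, hs, hs2⟩ : ∃ s : ℝ, s ≠ 0 ∧ s ^ 2 = G x w w :=
    ⟨√(G x w w), (Real.sqrt_pos.2 hpos).ne', Real.sq_sqrt hpos.le⟩
  have e := sectional (s⁻¹ • w) ?_ ?_
  · simp only [map_smul, h.curvatureOf_smul₁ hx, h.curvatureOf_smul₂ hx, h.curvatureOf_smul₃ hx,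
      smul_apply, smul_eq_mul] at e
    rw [← hs2, ← e]
    field_simp
  · simp only [map_smul, smul_apply, smul_eq_mul, ← hs2]
    field_simp
  · rw [map_smul, smul_apply, (h.contact x hx).inner_ξ, hw, smul_zero]

end IsSasakianOn

end SasakianCalculus

/-! ### Passage between tensor fields on the manifold and their chart expressions. -/

section Charts

variable {m : ℕ} {N : Type*} [TopologicalSpace N]
  [ChartedSpace (EuclideanSpace ℝ (Fin m)) N] [IsManifold (𝓡 m) ∞ N]

/-- A field of endomorphisms in the preferred chart at `p`. -/
def endCoord (φ : ∀ q : N, TangentSpace (𝓡 m) q →L[ℝ] TangentSpace (𝓡 m) q) (p : N)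
    (x : EuclideanSpace ℝ (Fin m)) : EuclideanSpace ℝ (Fin m) →L[ℝ] EuclideanSpace ℝ (Fin m) :=
  ((trivializationAt (EuclideanSpace ℝ (Fin m)) (TangentSpace (𝓡 m)) p).continuousLinearMapAt ℝ
    ((extChartAt (𝓡 m) p).symm x)).comp
    ((φ ((extChartAt (𝓡 m) p).symm x)).comp (ofCoords p ((extChartAt (𝓡 m) p).symm x)))

/-- A 1-form in the preferred chart at `p`. -/
def formCoord (η : ∀ q : N, TangentSpace (𝓡 m) q →L[ℝ] ℝ) (p : N)
    (x : EuclideanSpace ℝ (Fin m)) : EuclideanSpace ℝ (Fin m) →L[ℝ] ℝ :=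
  (η ((extChartAt (𝓡 m) p).symm x)).comp (ofCoords p ((extChartAt (𝓡 m) p).symm x))

/-- A vector field in the preferred chart at `p`. -/
def fieldCoord (X : ∀ q : N, TangentSpace (𝓡 m) q) (p : N) (x : EuclideanSpace ℝ (Fin m)) :
    EuclideanSpace ℝ (Fin m) :=
  coords p (X ((extChartAt (𝓡 m) p).symm x))

theorem mem_baseSet {p q : N} (hq : q ∈ (extChartAt (𝓡 m) p).source) :
    q ∈ (trivializationAt (EuclideanSpace ℝ (Fin m)) (TangentSpace (𝓡 m)) p).baseSet := by
  rw [extChartAt_source] at hq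
  rwa [TangentBundle.trivializationAt_baseSet]

theorem coords_ofCoords {p q : N} (hq : q ∈ (extChartAt (𝓡 m) p).source)
    (u : EuclideanSpace ℝ (Fin m)) : coords p (ofCoords p q u) = u :=
  Bundle.Trivialization.continuousLinearMapAt_symmL _ (mem_baseSet hq) u

theorem ofCoords_coords {p q : N} (hq : q ∈ (extChartAt (𝓡 m) p).source)
    (v : TangentSpace (𝓡 m) q) : ofCoords p q (coords p v) = v :=
  Bundle.Trivialization.symmL_continuousLinearMapAt _ (mem_baseSet hq) v

theorem coords_add (p : N) {q : N} (u v : TangentSpace (𝓡 m) q) :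
    coords p (u + v) = coords p u + coords p v := map_add _ u v

theorem coords_smul (p : N) {q : N} (a : ℝ) (v : TangentSpace (𝓡 m) q) :
    coords p (a • v) = a • coords p v := map_smul _ a v

theorem coords_zero (p : N) {q : N} : coords p (0 : TangentSpace (𝓡 m) q) = 0 := map_zero _

/-- The base point of `metricCoord` is the image of `q` under chart and inverse chart, equal to `q`
only propositionally, while the tangent spaces depend on it. Generalizing over a point `q' = q`
before substituting avoids transport; the next three lemmas do the same. -/
theorem metricCoord_apply (g : Metric m N) (p : N) {q : N}
    (hq : q ∈ (extChartAt (𝓡 m) p).source) (u v : TangentSpace (𝓡 m) q) :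
    metricCoord g p (extChartAt (𝓡 m) p q) (coords p u) (coords p v) = g.inner q u v := by
  have key : ∀ q' : N, q' = q → g.inner q' (ofCoords p q' (coords p u)) (ofCoords p q' (coords p v))
      = g.inner q u v := by
    rintro q' rfl
    rw [ofCoords_coords hq, ofCoords_coords hq]
  exact key _ ((extChartAt (𝓡 m) p).left_inv hq)

theorem endCoord_apply (φ : ∀ q : N, TangentSpace (𝓡 m) q →L[ℝ] TangentSpace (𝓡 m) q) (p : N)
    {q : N} (hq : q ∈ (extChartAt (𝓡 m) p).source) (v : TangentSpace (𝓡 m) q) :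
    endCoord φ p (extChartAt (𝓡 m) p q) (coords p v) = coords p (φ q v) := by
  have key : ∀ q' : N, q' = q → coords p (φ q' (ofCoords p q' (coords p v))) = coords p (φ q v) := by
    rintro q' rfl
    rw [ofCoords_coords hq]
  exact key _ ((extChartAt (𝓡 m) p).left_inv hq)

theorem formCoord_apply (η : ∀ q : N, TangentSpace (𝓡 m) q →L[ℝ] ℝ) (p : N)
    {q : N} (hq : q ∈ (extChartAt (𝓡 m) p).source) (v : TangentSpace (𝓡 m) q) :
    formCoord η p (extChartAt (𝓡 m) p q) (coords p v) = η q v := by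
  have key : ∀ q' : N, q' = q → η q' (ofCoords p q' (coords p v)) = η q v := by
    rintro q' rfl
    rw [ofCoords_coords hq]
  exact key _ ((extChartAt (𝓡 m) p).left_inv hq)

theorem fieldCoord_apply (X : ∀ q : N, TangentSpace (𝓡 m) q) (p : N)
    {q : N} (hq : q ∈ (extChartAt (𝓡 m) p).source) :
    fieldCoord X p (extChartAt (𝓡 m) p q) = coords p (X q) := by
  have key : ∀ q' : N, q' = q → coords p (X q') = coords p (X q) := by
    rintro q' rfl; rfl
  exact key _ ((extChartAt (𝓡 m) p).left_inv hq)

theorem smoothFieldAt_iff (X : ∀ q : N, TangentSpace (𝓡 m) q) (p : N)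
    {q : N} (hq : q ∈ (extChartAt (𝓡 m) p).source) :
    SmoothFieldAt X q ↔ ContMDiffAt (𝓡 m) 𝓘(ℝ, EuclideanSpace ℝ (Fin m)) ∞
      (fun q => coords p (X q)) q := by
  have hb := mem_baseSet hq
  rw [SmoothFieldAt]
  rw [(trivializationAt (EuclideanSpace ℝ (Fin m)) (TangentSpace (𝓡 m)) p).contMDiffAt_section_iff
    hb]
  refine Filter.EventuallyEq.contMDiffAt_iff ?_
  filter_upwards [(trivializationAt (EuclideanSpace ℝ (Fin m))
    (TangentSpace (𝓡 m)) p).open_baseSet.mem_nhds hb] with q' hq'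
  exact (congrFun (Bundle.Trivialization.coe_linearMapAt_of_mem (R := ℝ)
    (trivializationAt (EuclideanSpace ℝ (Fin m)) (TangentSpace (𝓡 m)) p) hq') (X q')).symm

theorem contDiffAt_comp_symm {F : Type*} [NormedAddCommGroup F] [NormedSpace ℝ F] {f : N → F}
    {p : N} {x : EuclideanSpace ℝ (Fin m)} (hx : x ∈ (extChartAt (𝓡 m) p).target)
    (hf : ContMDiffAt (𝓡 m) 𝓘(ℝ, F) ∞ f ((extChartAt (𝓡 m) p).symm x)) :
    ContDiffAt ℝ ∞ (fun y => f ((extChartAt (𝓡 m) p).symm y)) x := by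
  have h1 : ContMDiffAt 𝓘(ℝ, EuclideanSpace ℝ (Fin m)) (𝓡 m) ∞ (extChartAt (𝓡 m) p).symm x :=
    (contMDiffOn_extChartAt_symm p).contMDiffAt ((isOpen_extChartAt_target p).mem_nhds hx)
  exact (ContMDiffAt.comp x hf h1).contDiffAt

theorem contDiffAt_fieldCoord {X : ∀ q : N, TangentSpace (𝓡 m) q} {p : N}
    {x : EuclideanSpace ℝ (Fin m)} (hx : x ∈ (extChartAt (𝓡 m) p).target)
    (hX : SmoothFieldAt X ((extChartAt (𝓡 m) p).symm x)) :
    ContDiffAt ℝ ∞ (fieldCoord X p) x :=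
  contDiffAt_comp_symm hx ((smoothFieldAt_iff X p ((extChartAt (𝓡 m) p).map_target hx)).1 hX)

theorem smoothFieldAt_ofCoords {p q : N} (hq : q ∈ (extChartAt (𝓡 m) p).source)
    (u : EuclideanSpace ℝ (Fin m)) : SmoothFieldAt (fun q => ofCoords p q u) q := by
  rw [smoothFieldAt_iff _ p hq]
  refine (contMDiffAt_const (c := u)).congr_of_eventuallyEq ?_
  filter_upwards [(isOpen_extChartAt_source p).mem_nhds hq] with q' hq'
  exact coords_ofCoords hq' u

theorem coords_eq_mfderiv {p q : N} (hq : q ∈ (extChartAt (𝓡 m) p).source)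
    (v : TangentSpace (𝓡 m) q) :
    coords p v = mfderiv (𝓡 m) 𝓘(ℝ, EuclideanSpace ℝ (Fin m)) (extChartAt (𝓡 m) p) q v := by
  rw [coords, TangentBundle.continuousLinearMapAt_trivializationAt
    (by rwa [← extChartAt_source (𝓡 m)])]
  rfl

theorem dirDeriv_eq_fderiv {f : N → ℝ} {p : N} {x : EuclideanSpace ℝ (Fin m)}
    (hx : x ∈ (extChartAt (𝓡 m) p).target)
    (hf : MDifferentiableAt (𝓡 m) 𝓘(ℝ, ℝ) f ((extChartAt (𝓡 m) p).symm x))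
    (u : EuclideanSpace ℝ (Fin m)) :
    dirDeriv f (ofCoords p ((extChartAt (𝓡 m) p).symm x) u)
      = fderiv ℝ (fun y => f ((extChartAt (𝓡 m) p).symm y)) x u := by
  have hq := (extChartAt (𝓡 m) p).map_target hx
  set q := (extChartAt (𝓡 m) p).symm x with hqx
  have h1 : DifferentiableAt ℝ (fun y => f ((extChartAt (𝓡 m) p).symm y)) x := by
    have h1 : MDifferentiableAt 𝓘(ℝ, EuclideanSpace ℝ (Fin m)) (𝓡 m) (extChartAt (𝓡 m) p).symm x :=
      ((contMDiffOn_extChartAt_symm (n := ∞) p).contMDiffAt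
        ((isOpen_extChartAt_target p).mem_nhds hx)).mdifferentiableAt (by simp)
    exact (MDifferentiableAt.comp x hf h1).differentiableAt
  have hxq : extChartAt (𝓡 m) p q = x := (extChartAt (𝓡 m) p).right_inv hx
  have h2 : MDifferentiableAt (𝓡 m) 𝓘(ℝ, EuclideanSpace ℝ (Fin m)) (extChartAt (𝓡 m) p) q :=
    mdifferentiableAt_extChartAt (by rwa [← extChartAt_source (𝓡 m)])
  have e1 : mfderiv (𝓡 m) 𝓘(ℝ, ℝ) f q
      = mfderiv (𝓡 m) 𝓘(ℝ, ℝ) ((fun y => f ((extChartAt (𝓡 m) p).symm y)) ∘ extChartAt (𝓡 m) p) q := by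
    refine Filter.EventuallyEq.mfderiv_eq ?_
    filter_upwards [(isOpen_extChartAt_source p).mem_nhds hq] with q' hq'
    simp only [Function.comp_apply, (extChartAt (𝓡 m) p).left_inv hq']
  have h1' : MDifferentiableAt 𝓘(ℝ, EuclideanSpace ℝ (Fin m)) 𝓘(ℝ, ℝ)
      (fun y => f ((extChartAt (𝓡 m) p).symm y)) (extChartAt (𝓡 m) p q) := by
    rw [hxq]; exact h1.mdifferentiableAt
  rw [dirDeriv, e1, mfderiv_comp q h1' h2, mfderiv_eq_fderiv, hxq]
  change fderiv ℝ (fun y => f ((extChartAt (𝓡 m) p).symm y)) x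
    (mfderiv (𝓡 m) 𝓘(ℝ, EuclideanSpace ℝ (Fin m)) (extChartAt (𝓡 m) p) q (ofCoords p q u)) = _
  rw [← coords_eq_mfderiv hq, coords_ofCoords hq]

/-- The bracket is natural under pullback by the inverse chart, and the pulled-back fields are the
coordinate expressions, so the vector space formula applies. -/
theorem coords_mlieBracket {X Y : ∀ q : N, TangentSpace (𝓡 m) q} {p : N}
    {x : EuclideanSpace ℝ (Fin m)} (hx : x ∈ (extChartAt (𝓡 m) p).target)
    (hX : SmoothFieldAt X ((extChartAt (𝓡 m) p).symm x))
    (hY : SmoothFieldAt Y ((extChartAt (𝓡 m) p).symm x)) :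
    coords p (VectorField.mlieBracket (𝓡 m) X Y ((extChartAt (𝓡 m) p).symm x))
      = fderiv ℝ (fieldCoord Y p) x (fieldCoord X p x)
        - fderiv ℝ (fieldCoord X p) x (fieldCoord Y p x) := by
  have h1 : ContMDiffAt 𝓘(ℝ, EuclideanSpace ℝ (Fin m)) (𝓡 m) 2 (extChartAt (𝓡 m) p).symm x :=
    ((contMDiffOn_extChartAt_symm (n := ∞) p).contMDiffAt
        ((isOpen_extChartAt_target p).mem_nhds hx)).of_le ENat.LEInfty.out
  have : IsManifold (𝓡 m) (minSmoothness ℝ 2) N := by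
    rw [minSmoothness_of_isRCLikeNormedField]; infer_instance
  have h2 := VectorField.mpullback_mlieBracket (hX.mdifferentiableAt (by simp))
    (hY.mdifferentiableAt (by simp)) h1 (by simp)
  have h3 : ∀ y ∈ (extChartAt (𝓡 m) p).target, ∀ Z : ∀ q : N, TangentSpace (𝓡 m) q,
      VectorField.mpullback 𝓘(ℝ, EuclideanSpace ℝ (Fin m)) (𝓡 m) (extChartAt (𝓡 m) p).symm Z y
        = fieldCoord Z p y := by
    intro y hy Z
    have e1 := mfderivWithin_extChartAt_symm_comp_mfderiv_extChartAt (I := 𝓡 m) hy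
    have e2 := mfderiv_extChartAt_comp_mfderivWithin_extChartAt_symm (I := 𝓡 m) hy
    rw [ModelWithCorners.range_eq_univ, mfderivWithin_univ] at e1 e2
    rw [VectorField.mpullback_apply, ContinuousLinearMap.inverse_eq e1 e2, fieldCoord,
      coords_eq_mfderiv ((extChartAt (𝓡 m) p).map_target hy)]
    rfl
  have h4 : ∀ Z : ∀ q : N, TangentSpace (𝓡 m) q,
      VectorField.mpullback 𝓘(ℝ, EuclideanSpace ℝ (Fin m)) (𝓡 m) (extChartAt (𝓡 m) p).symm Z
        =ᶠ[nhds x] fieldCoord Z p := fun Z =>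
    Filter.eventually_of_mem ((isOpen_extChartAt_target p).mem_nhds hx) (fun y hy => h3 y hy Z)
  rw [h3 x hx] at h2
  rw [Filter.EventuallyEq.mlieBracket_vectorField_eq (h4 X) (h4 Y)] at h2
  rw [fieldCoord] at h2
  have h5 : ∀ V W : ∀ y : EuclideanSpace ℝ (Fin m),
      TangentSpace 𝓘(ℝ, EuclideanSpace ℝ (Fin m)) y,
      VectorField.mlieBracket 𝓘(ℝ, EuclideanSpace ℝ (Fin m)) V W x
        = VectorField.lieBracket ℝ V W x := by
    intro V W
    rw [← VectorField.mlieBracketWithin_univ, VectorField.mlieBracketWithin_eq_lieBracketWithin]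
    exact congrFun VectorField.lieBracketWithin_univ x
  exact h2.trans (h5 _ _)

end Charts

/-! ### A Sasakian structure read in a chart. -/

section SasakianCharts

variable {m : ℕ} {N : Type*} [TopologicalSpace N]
  [ChartedSpace (EuclideanSpace ℝ (Fin m)) N] [IsManifold (𝓡 m) ∞ N]

omit [IsManifold (𝓡 m) ∞ N] in
theorem contMDiffAt_real_of_trivial {f : N → ℝ} {q : N}
    (hf : ContMDiffAt (𝓡 m) ((𝓡 m).prod 𝓘(ℝ, ℝ)) ∞
      (fun q => Bundle.TotalSpace.mk' ℝ (E := Bundle.Trivial N ℝ) q (f q)) q) :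
    ContMDiffAt (𝓡 m) 𝓘(ℝ, ℝ) ∞ f q := by
  rw [Bundle.contMDiffAt_totalSpace] at hf
  exact hf.2

theorem Metric.contMDiffAt_inner (g : Metric m N) {X Y : ∀ q : N, TangentSpace (𝓡 m) q} {q : N}
    (hX : SmoothFieldAt X q) (hY : SmoothFieldAt Y q) :
    ContMDiffAt (𝓡 m) 𝓘(ℝ, ℝ) ∞ (fun q => g.inner q (X q) (Y q)) q :=
  contMDiffAt_real_of_trivial (ContMDiffAt.clm_bundle_apply₂ (F₁ := EuclideanSpace ℝ (Fin m))
    (F₂ := EuclideanSpace ℝ (Fin m)) g.contMDiff.contMDiffAt hX hY)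

theorem Structure.smoothFieldAt_φ (S : Structure m N) {X : ∀ q : N, TangentSpace (𝓡 m) q} {q : N}
    (hX : SmoothFieldAt X q) : SmoothFieldAt (fun q => S.φ q (X q)) q :=
  ContMDiffAt.clm_bundle_apply (F₁ := EuclideanSpace ℝ (Fin m))
    (F₂ := EuclideanSpace ℝ (Fin m)) S.smooth_φ.contMDiffAt hX

theorem Structure.contMDiffAt_η (S : Structure m N) {X : ∀ q : N, TangentSpace (𝓡 m) q} {q : N}
    (hX : SmoothFieldAt X q) : ContMDiffAt (𝓡 m) 𝓘(ℝ, ℝ) ∞ (fun q => S.η q (X q)) q :=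
  contMDiffAt_real_of_trivial (ContMDiffAt.clm_bundle_apply (F₁ := EuclideanSpace ℝ (Fin m))
    (F₂ := ℝ) S.smooth_η.contMDiffAt hX)

theorem isMetricOn_metricCoord (g : Metric m N) (p : N) :
    IsMetricOn (metricCoord g p) (extChartAt (𝓡 m) p).target where
  isOpen := isOpen_extChartAt_target p
  smooth := by
    rw [contDiffOn_clm_apply]
    intro u
    rw [contDiffOn_clm_apply]
    intro v x hx
    have hq := (extChartAt (𝓡 m) p).map_target hx
    exact (contDiffAt_comp_symm hx (g.contMDiffAt_inner (smoothFieldAt_ofCoords hq u)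
      (smoothFieldAt_ofCoords hq v))).contDiffWithinAt
  symm x _ u v := g.symm _ _ _
  pos x hx u hu := by
    refine g.pos _ _ fun h0 => hu ?_
    have h1 : ofCoords p ((extChartAt (𝓡 m) p).symm x) u = 0 := h0
    rw [← coords_ofCoords ((extChartAt (𝓡 m) p).map_target hx) u, h1, coords_zero]

theorem coords_endo {φ : ∀ q : N, TangentSpace (𝓡 m) q →L[ℝ] TangentSpace (𝓡 m) q} {p : N}
    {x : EuclideanSpace ℝ (Fin m)} (hx : x ∈ (extChartAt (𝓡 m) p).target)
    (v : TangentSpace (𝓡 m) ((extChartAt (𝓡 m) p).symm x)) :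
    coords p (φ _ v) = endCoord φ p x (coords p v) := by
  change _ = coords p (φ _ (ofCoords p _ (coords p v)))
  rw [ofCoords_coords ((extChartAt (𝓡 m) p).map_target hx)]

/-- The coordinate representation of a Sasakian structure. -/
theorem Structure.isSasakianOn (S : Structure m N) (p : N) :
    IsSasakianOn (metricCoord S.g p) (endCoord S.φ p) (fieldCoord S.ξ p) (formCoord S.η p)
      (extChartAt (𝓡 m) p).target := by
  have smooth_φ : ContDiffOn ℝ ∞ (endCoord S.φ p) (extChartAt (𝓡 m) p).target := by
    rw [contDiffOn_clm_apply]
    intro u x hx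
    have hq := (extChartAt (𝓡 m) p).map_target hx
    exact (contDiffAt_fieldCoord hx
      (S.smoothFieldAt_φ (smoothFieldAt_ofCoords hq u))).contDiffWithinAt
  have smooth_η : ContDiffOn ℝ ∞ (formCoord S.η p) (extChartAt (𝓡 m) p).target := by
    rw [contDiffOn_clm_apply]
    intro u x hx
    have hq := (extChartAt (𝓡 m) p).map_target hx
    exact (contDiffAt_comp_symm hx
      (S.contMDiffAt_η (smoothFieldAt_ofCoords hq u))).contDiffWithinAt
  -- The test fields have constant coordinates, so they commute; dη and the Nijenhuis tensor then
  -- reduce to partial derivatives of the coordinate tensors.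
  have hfield : ∀ x ∈ (extChartAt (𝓡 m) p).target, ∀ u,
      fieldCoord (fun q => ofCoords p q u) p x = u := fun x hx u =>
    coords_ofCoords ((extChartAt (𝓡 m) p).map_target hx) u
  have hfield' : ∀ x ∈ (extChartAt (𝓡 m) p).target, ∀ u,
      fderiv ℝ (fieldCoord (fun q => ofCoords p q u) p) x = 0 := by
    intro x hx u
    rw [fderiv_congr_on (isOpen_extChartAt_target p) hx (fun y hy => hfield y hy u)]
    simp
  have hφu : ∀ x ∈ (extChartAt (𝓡 m) p).target, ∀ u,
      fieldCoord (fun q => S.φ q (ofCoords p q u)) p x = endCoord S.φ p x u := fun x hx u => rfl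
  have hφu' : ∀ x ∈ (extChartAt (𝓡 m) p).target, ∀ u w,
      fderiv ℝ (fieldCoord (fun q => S.φ q (ofCoords p q u)) p) x w
        = fderiv ℝ (endCoord S.φ p) x w u := by
    intro x hx u w
    rw [fderiv_congr_on (isOpen_extChartAt_target p) hx (fun y hy => hφu y hy u)]
    exact fderiv_clm_apply_const ((smooth_φ.contDiffAt
      ((isOpen_extChartAt_target p).mem_nhds hx)).differentiableAt (by simp)) u w
  have hbracket : ∀ x ∈ (extChartAt (𝓡 m) p).target, ∀ u v,
      coords p (VectorField.mlieBracket (𝓡 m) (fun q => ofCoords p q u) (fun q => ofCoords p q v)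
        ((extChartAt (𝓡 m) p).symm x)) = 0 := by
    intro x hx u v
    have hq := (extChartAt (𝓡 m) p).map_target hx
    rw [coords_mlieBracket hx (smoothFieldAt_ofCoords hq u) (smoothFieldAt_ofCoords hq v),
      hfield' x hx, hfield' x hx]
    simp
  have hd : ∀ x ∈ (extChartAt (𝓡 m) p).target, ∀ u v,
      extDerivForm S.η (fun q => ofCoords p q u) (fun q => ofCoords p q v)
          ((extChartAt (𝓡 m) p).symm x)
        = 1 / 2 * (fderiv ℝ (formCoord S.η p) x u v - fderiv ℝ (formCoord S.η p) x v u) := by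
    intro x hx u v
    have hq := (extChartAt (𝓡 m) p).map_target hx
    have e1 : ∀ u v, dirDeriv (fun q => S.η q (ofCoords p q v))
        (ofCoords p ((extChartAt (𝓡 m) p).symm x) u) = fderiv ℝ (formCoord S.η p) x u v := by
      intro u v
      rw [dirDeriv_eq_fderiv hx ((S.contMDiffAt_η
        (smoothFieldAt_ofCoords hq v)).mdifferentiableAt (by simp))]
      exact fderiv_clm_apply_const ((smooth_η.contDiffAt
        ((isOpen_extChartAt_target p).mem_nhds hx)).differentiableAt (by simp)) v u
    have e2 := ofCoords_coords hq (VectorField.mlieBracket (𝓡 m) (fun q => ofCoords p q u)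
      (fun q => ofCoords p q v) ((extChartAt (𝓡 m) p).symm x))
    rw [hbracket x hx, map_zero] at e2
    rw [extDerivForm, e1, e1, ← e2, map_zero, sub_zero]
  refine { isMetricOn_metricCoord S.g p with
    smooth_φ := smooth_φ
    smooth_ξ := fun x hx => (contDiffAt_fieldCoord hx S.smooth_ξ.contMDiffAt).contDiffWithinAt
    smooth_η := smooth_η
    contact := ?_
    inner_φ := ?_
    normal := ?_ }
  · intro x hx
    have hq := (extChartAt (𝓡 m) p).map_target hx
    refine ⟨(isMetricOn_metricCoord S.g p).symm x hx, (isMetricOn_metricCoord S.g p).pos x hx,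
      ?_, ?_, ?_⟩
    · intro u
      have e := congrArg (coords p) (S.φ_sq _ (ofCoords p ((extChartAt (𝓡 m) p).symm x) u))
      rw [coords_endo hx, coords_endo hx, coords_ofCoords hq, coords_add, coords_smul,
        ← neg_one_smul ℝ (ofCoords p ((extChartAt (𝓡 m) p).symm x) u), coords_smul,
        coords_ofCoords hq, neg_one_smul] at e
      exact e
    · change S.η _ (ofCoords p _ (coords p (S.ξ _))) = 1
      rw [ofCoords_coords hq, S.η_ξ]
    · intro u v
      change S.g.inner _ (ofCoords p _ (coords p (S.φ _ (ofCoords p _ u))))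
        (ofCoords p _ (coords p (S.φ _ (ofCoords p _ v)))) = _
      rw [ofCoords_coords hq, ofCoords_coords hq, S.g_φ_φ]
      rfl
  · intro x hx u v
    have hq := (extChartAt (𝓡 m) p).map_target hx
    rw [← hd x hx, ← S.g_φ _ _ _ (smoothFieldAt_ofCoords hq u) (smoothFieldAt_ofCoords hq v)]
    change S.g.inner _ (ofCoords p _ u) (ofCoords p _ (coords p (S.φ _ (ofCoords p _ v)))) = _
    rw [ofCoords_coords hq]
  · intro x hx u v
    have hq := (extChartAt (𝓡 m) p).map_target hx
    have hu := smoothFieldAt_ofCoords hq u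
    have hv := smoothFieldAt_ofCoords hq v
    have e := congrArg (coords p) (S.normal _ _ _ hu hv)
    rw [← S.g_φ _ _ _ hu hv, nijenhuis] at e
    have e1 := coords_mlieBracket hx (S.smoothFieldAt_φ hu) (S.smoothFieldAt_φ hv)
    have e2 := coords_mlieBracket hx (S.smoothFieldAt_φ hu) hv
    have e3 := coords_mlieBracket hx hu (S.smoothFieldAt_φ hv)
    rw [hφu x hx, hφu x hx, hφu' x hx, hφu' x hx] at e1
    rw [hφu x hx, hφu' x hx, hfield x hx, hfield' x hx] at e2
    rw [hφu x hx, hφu' x hx, hfield x hx, hfield' x hx] at e3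
    have csub : ∀ a b : TangentSpace (𝓡 m) ((extChartAt (𝓡 m) p).symm x),
        coords p (a - b) = coords p a - coords p b := fun a b => map_sub _ a b
    rw [coords_add, coords_add, csub, csub, coords_smul, coords_zero, coords_endo hx,
      coords_endo hx, coords_endo hx, coords_endo hx, hbracket x hx, e1, e2, e3, map_zero,
      map_zero, zero_apply, zero_apply, zero_sub, sub_zero, map_neg] at e
    have e4 : metricCoord S.g p x u (endCoord S.φ p x v)
        = S.g.inner _ (ofCoords p ((extChartAt (𝓡 m) p).symm x) u)
          (S.φ _ (ofCoords p ((extChartAt (𝓡 m) p).symm x) v)) := by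
      change S.g.inner _ (ofCoords p _ u) (ofCoords p _ (coords p (S.φ _ (ofCoords p _ v)))) = _
      rw [ofCoords_coords hq]
    rw [e4, ← e]
    simp only [fieldCoord]
    abel

end SasakianCharts

/-! ### Curvature at a point, and covariant differentiation along curves. -/

section Curves

variable {m : ℕ} {N : Type*} [TopologicalSpace N]
  [ChartedSpace (EuclideanSpace ℝ (Fin m)) N] [IsManifold (𝓡 m) ∞ N]

/-- The curvature tensor of a Sasakian space form on orthogonal horizontal vectors. -/
theorem Structure.IsSpaceForm.curvature_eq {S : Structure m N} {c : ℝ} (hS : S.IsSpaceForm c)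
    {p : N} {u v : TangentSpace (𝓡 m) p} (hu : S.η p u = 0) (hv : S.η p v = 0)
    (huu : S.g.inner p u u = 1) (huv : S.g.inner p u v = 0) :
    curvature S.g p u v u
      = -((c + 3) / 4) • v - (3 * (c - 1) / 4 * S.g.inner p v (S.φ p u)) • S.φ p u := by
  have h := S.isSasakianOn p
  have hp := mem_extChartAt_source (I := 𝓡 m) p
  have hx := mem_extChartAt_target (I := 𝓡 m) p
  have hR : ∀ u v w : TangentSpace (𝓡 m) p, curvature S.g p u v w = ofCoords p p
      (curvatureOf (metricCoord S.g p) (extChartAt (𝓡 m) p p) (coords p u) (coords p v)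
        (coords p w)) := fun u v w => rfl
  have e := h.curvatureOf_of_sectional hx c (u := coords p u) (v := coords p v) ?_ ?_ ?_ ?_ ?_
  · rw [hR, e, endCoord_apply _ _ hp, metricCoord_apply _ _ hp, map_sub, map_smul, map_smul,
      ofCoords_coords hp, ofCoords_coords hp]
  · intro w hw1 hw2
    rw [← coords_ofCoords hp w, metricCoord_apply _ _ hp] at hw1
    rw [← coords_ofCoords hp w, fieldCoord_apply _ _ hp, metricCoord_apply _ _ hp] at hw2
    have := hS p _ hw1 hw2
    rw [hR, ← metricCoord_apply _ _ hp, coords_ofCoords hp, ← endCoord_apply _ _ hp,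
      coords_ofCoords hp] at this
    exact this
  · rw [formCoord_apply _ _ hp, hu]
  · rw [formCoord_apply _ _ hp, hv]
  · rw [metricCoord_apply _ _ hp, huu]
  · rw [metricCoord_apply _ _ hp, huv]

theorem curvature_smul (g : Metric m N) {p : N} (a : ℝ) (u v w : TangentSpace (𝓡 m) p) :
    curvature g p u (a • v) w = a • curvature g p u v w := by
  have hR : ∀ u v w : TangentSpace (𝓡 m) p, curvature g p u v w = ofCoords p p
      (curvatureOf (metricCoord g p) (extChartAt (𝓡 m) p p) (coords p u) (coords p v)
        (coords p w)) := fun u v w => rfl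
  rw [hR, hR, coords_smul,
    (isMetricOn_metricCoord g p).curvatureOf_smul₂ (mem_extChartAt_target (I := 𝓡 m) p), map_smul]

/-- The vector field `V` along `γ` is differentiable at `t`, in the preferred chart. -/
def DifferentiableAlong (γ : ℝ → N) (V : ∀ t, TangentSpace (𝓡 m) (γ t)) (t : ℝ) : Prop :=
  DifferentiableAt ℝ (fun s => coords (γ t) (V s)) t

variable {γ : ℝ → N} {V W : ∀ t, TangentSpace (𝓡 m) (γ t)} {t : ℝ}

theorem hasDerivAt_extChartAt (hγ : MDifferentiableAt 𝓘(ℝ, ℝ) (𝓡 m) γ t) :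
    HasDerivAt (fun s => extChartAt (𝓡 m) (γ t) (γ s)) (coords (γ t) (velocity γ t)) t := by
  have h2 : MDifferentiableAt (𝓡 m) 𝓘(ℝ, EuclideanSpace ℝ (Fin m)) (extChartAt (𝓡 m) (γ t)) (γ t) :=
    mdifferentiableAt_extChartAt (mem_chart_source _ _)
  have h3 := (h2.comp t hγ).differentiableAt.hasFDerivAt.hasDerivAt
  refine h3.congr_deriv ?_
  symm
  rw [coords_eq_mfderiv (mem_extChartAt_source _), ← mfderiv_eq_fderiv, mfderiv_comp t h2 hγ]
  rfl

omit [IsManifold (𝓡 m) ∞ N] in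
theorem eventually_mem_source (hγ : MDifferentiableAt 𝓘(ℝ, ℝ) (𝓡 m) γ t) :
    ∀ᶠ s in nhds t, γ s ∈ (extChartAt (𝓡 m) (γ t)).source :=
  hγ.continuousAt.eventually_mem
    ((isOpen_extChartAt_source (γ t)).mem_nhds (mem_extChartAt_source _))

theorem coords_injective {p : N} {u v : TangentSpace (𝓡 m) p} (h : coords p u = coords p v) :
    u = v := by
  rw [← ofCoords_coords (mem_extChartAt_source (I := 𝓡 m) p) u, h,
    ofCoords_coords (mem_extChartAt_source (I := 𝓡 m) p)]

theorem coords_covDeriv (g : Metric m N) (γ : ℝ → N) (V : ∀ t, TangentSpace (𝓡 m) (γ t)) (t : ℝ) :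
    coords (γ t) (covDeriv g γ V t) = deriv (fun s => coords (γ t) (V s)) t
      + christoffelMap (metricCoord g (γ t)) (extChartAt (𝓡 m) (γ t) (γ t))
        (coords (γ t) (velocity γ t)) (coords (γ t) (V t)) := by
  rw [covDeriv, coords_ofCoords (mem_extChartAt_source _), christoffelMap_apply]
  rfl

theorem covDeriv_congr (g : Metric m N) (h : ∀ᶠ s in nhds t, V s = W s) :
    covDeriv g γ V t = covDeriv g γ W t := by
  apply coords_injective
  rw [coords_covDeriv, coords_covDeriv, h.self_of_nhds]
  congr 1
  refine Filter.EventuallyEq.deriv_eq ?_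
  filter_upwards [h] with s hs
  rw [hs]

theorem DifferentiableAlong.add (hV : DifferentiableAlong γ V t)
    (hW : DifferentiableAlong γ W t) : DifferentiableAlong γ (fun s => V s + W s) t := by
  simp only [DifferentiableAlong, coords_add]
  exact DifferentiableAt.fun_add hV hW

theorem DifferentiableAlong.smul {f : ℝ → ℝ} (hf : DifferentiableAt ℝ f t)
    (hV : DifferentiableAlong γ V t) : DifferentiableAlong γ (fun s => f s • V s) t := by
  simp only [DifferentiableAlong, coords_smul]
  exact DifferentiableAt.fun_smul hf hV

theorem covDeriv_add (g : Metric m N) (hV : DifferentiableAlong γ V t)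
    (hW : DifferentiableAlong γ W t) :
    covDeriv g γ (fun s => V s + W s) t = covDeriv g γ V t + covDeriv g γ W t := by
  apply coords_injective
  simp only [coords_covDeriv, coords_add]
  rw [deriv_fun_add hV hW, map_add]
  abel

theorem covDeriv_smul (g : Metric m N) {f : ℝ → ℝ} (hf : DifferentiableAt ℝ f t)
    (hV : DifferentiableAlong γ V t) :
    covDeriv g γ (fun s => f s • V s) t = deriv f t • V t + f t • covDeriv g γ V t := by
  apply coords_injective
  simp only [coords_covDeriv, coords_add, coords_smul]
  rw [deriv_fun_smul hf hV, map_smul, smul_add]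
  abel

theorem covDeriv_zero (g : Metric m N) :
    covDeriv g γ (fun s => (0 : TangentSpace (𝓡 m) (γ s))) t = 0 := by
  apply coords_injective
  simp only [coords_covDeriv, coords_zero]
  simp

theorem differentiableAlong_of_contMDiffAt
    (h : ContMDiffAt 𝓘(ℝ, ℝ) (𝓡 m).tangent ∞
      (fun t => (⟨γ t, V t⟩ : TangentBundle (𝓡 m) N)) t) : DifferentiableAlong γ V t := by
  rw [Bundle.contMDiffAt_totalSpace] at h
  have h1 := (h.2.contDiffAt.differentiableAt (by simp))
  have h2 : ∀ᶠ s in nhds t, γ s ∈ (trivializationAt (EuclideanSpace ℝ (Fin m))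
      (TangentSpace (𝓡 m)) (γ t)).baseSet := by
    filter_upwards [eventually_mem_source (h.1.mdifferentiableAt (by simp))] with s hs
    exact mem_baseSet hs
  refine h1.congr_of_eventuallyEq ?_
  filter_upwards [h2] with s hs
  exact congrFun (Bundle.Trivialization.coe_linearMapAt_of_mem (R := ℝ)
    (trivializationAt (EuclideanSpace ℝ (Fin m)) (TangentSpace (𝓡 m)) (γ t)) hs) (V s)

/-- The Levi-Civita connection is metric. -/
theorem hasDerivAt_inner (g : Metric m N) (hγ : MDifferentiableAt 𝓘(ℝ, ℝ) (𝓡 m) γ t)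
    (hV : DifferentiableAlong γ V t) (hW : DifferentiableAlong γ W t) :
    HasDerivAt (fun s => g.inner (γ s) (V s) (W s))
      (g.inner (γ t) (covDeriv g γ V t) (W t) + g.inner (γ t) (V t) (covDeriv g γ W t)) t := by
  have hp := mem_extChartAt_source (I := 𝓡 m) (γ t)
  have hx := mem_extChartAt_target (I := 𝓡 m) (γ t)
  have hG := isMetricOn_metricCoord g (γ t)
  have h1 := (hG.differentiableAt hx).hasFDerivAt.comp_hasDerivAt t (hasDerivAt_extChartAt hγ)
  have h2 := (h1.clm_apply hV.hasDerivAt).clm_apply hW.hasDerivAt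
  refine (h2.congr_of_eventuallyEq ?_).congr_deriv ?_
  · filter_upwards [eventually_mem_source hγ] with s hs
    exact (metricCoord_apply g _ hs _ _).symm
  · rw [← metricCoord_apply g _ hp, ← metricCoord_apply g _ hp, coords_covDeriv, coords_covDeriv]
    simp only [Function.comp_apply, map_add, add_apply]
    rw [hG.fderiv_eq_christoffelMap hx]
    ring

theorem hasDerivAt_comp_endCoord (S : Structure m N)
    (hγ : MDifferentiableAt 𝓘(ℝ, ℝ) (𝓡 m) γ t) (hV : DifferentiableAlong γ V t) :
    HasDerivAt (fun s => coords (γ t) (S.φ (γ s) (V s)))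
      (fderiv ℝ (endCoord S.φ (γ t)) (extChartAt (𝓡 m) (γ t) (γ t)) (coords (γ t) (velocity γ t))
        (coords (γ t) (V t)) + endCoord S.φ (γ t) (extChartAt (𝓡 m) (γ t) (γ t))
        (deriv (fun s => coords (γ t) (V s)) t)) t := by
  have hx := mem_extChartAt_target (I := 𝓡 m) (γ t)
  have h := S.isSasakianOn (γ t)
  have h1 := (h.differentiableAt_φ hx).hasFDerivAt.comp_hasDerivAt t (hasDerivAt_extChartAt hγ)
  refine (h1.clm_apply hV.hasDerivAt).congr_of_eventuallyEq ?_
  filter_upwards [eventually_mem_source hγ] with s hs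
  exact (endCoord_apply _ _ hs _).symm

theorem DifferentiableAlong.φ (S : Structure m N)
    (hγ : MDifferentiableAt 𝓘(ℝ, ℝ) (𝓡 m) γ t) (hV : DifferentiableAlong γ V t) :
    DifferentiableAlong γ (fun s => S.φ (γ s) (V s)) t :=
  (hasDerivAt_comp_endCoord S hγ hV).differentiableAt

/-- `∇_T (φ V) = g(T, V) ξ - η(V) T + φ (∇_T V)`. -/
theorem covDeriv_φ (S : Structure m N) (hγ : MDifferentiableAt 𝓘(ℝ, ℝ) (𝓡 m) γ t)
    (hV : DifferentiableAlong γ V t) :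
    covDeriv S.g γ (fun s => S.φ (γ s) (V s)) t
      = S.g.inner (γ t) (velocity γ t) (V t) • S.ξ (γ t) - S.η (γ t) (V t) • velocity γ t
        + S.φ (γ t) (covDeriv S.g γ V t) := by
  have hp := mem_extChartAt_source (I := 𝓡 m) (γ t)
  have hx := mem_extChartAt_target (I := 𝓡 m) (γ t)
  have h := S.isSasakianOn (γ t)
  have csub : ∀ a b : TangentSpace (𝓡 m) (γ t),
      coords (γ t) (a - b) = coords (γ t) a - coords (γ t) b := fun a b => map_sub _ a b
  apply coords_injective
  rw [coords_covDeriv, (hasDerivAt_comp_endCoord S hγ hV).deriv, coords_add, csub, coords_smul,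
    coords_smul, ← endCoord_apply _ _ hp, ← endCoord_apply _ _ hp, coords_covDeriv,
    ← metricCoord_apply _ _ hp, ← formCoord_apply _ _ hp, ← fieldCoord_apply _ _ hp,
    ← h.nablaEnd_eq hx, nablaEnd, LinearMap.mk₂_apply, map_add]
  abel

theorem hasDerivAt_comp_fieldCoord (S : Structure m N)
    (hγ : MDifferentiableAt 𝓘(ℝ, ℝ) (𝓡 m) γ t) :
    HasDerivAt (fun s => coords (γ t) (S.ξ (γ s)))
      (fderiv ℝ (fieldCoord S.ξ (γ t)) (extChartAt (𝓡 m) (γ t) (γ t))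
        (coords (γ t) (velocity γ t))) t := by
  have hx := mem_extChartAt_target (I := 𝓡 m) (γ t)
  have h := S.isSasakianOn (γ t)
  have h1 := (h.differentiableAt_ξ hx).hasFDerivAt.comp_hasDerivAt t (hasDerivAt_extChartAt hγ)
  refine h1.congr_of_eventuallyEq ?_
  filter_upwards [eventually_mem_source hγ] with s hs
  exact (fieldCoord_apply _ _ hs).symm

theorem differentiableAlong_ξ (S : Structure m N) (hγ : MDifferentiableAt 𝓘(ℝ, ℝ) (𝓡 m) γ t) :
    DifferentiableAlong γ (fun s => S.ξ (γ s)) t :=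
  (hasDerivAt_comp_fieldCoord S hγ).differentiableAt

/-- `∇_T ξ = -φ T`. -/
theorem covDeriv_ξ (S : Structure m N) (hγ : MDifferentiableAt 𝓘(ℝ, ℝ) (𝓡 m) γ t) :
    covDeriv S.g γ (fun s => S.ξ (γ s)) t = -S.φ (γ t) (velocity γ t) := by
  have hp := mem_extChartAt_source (I := 𝓡 m) (γ t)
  have hx := mem_extChartAt_target (I := 𝓡 m) (γ t)
  have h := S.isSasakianOn (γ t)
  apply coords_injective
  rw [coords_covDeriv, (hasDerivAt_comp_fieldCoord S hγ).deriv, ← neg_one_smul ℝ (S.φ _ _),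
    coords_smul, ← endCoord_apply _ _ hp, neg_one_smul, ← h.nabla_ξ hx, nabla,
    fieldCoord_apply _ _ hp]

/-- The tensors of a Sasakian structure at a point. -/
theorem Structure.isContactMetric (S : Structure m N) (p : N) :
    IsContactMetric (E := EuclideanSpace ℝ (Fin m)) (S.g.inner p) (S.φ p) (S.ξ p) (S.η p) :=
  ⟨S.g.symm p, S.g.pos p, S.φ_sq p, S.η_ξ p, S.g_φ_φ p⟩

theorem Structure.inner_ξ (S : Structure m N) {p : N} (u : TangentSpace (𝓡 m) p) :
    S.g.inner p u (S.ξ p) = S.η p u := (S.isContactMetric p).inner_ξ u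

theorem Structure.inner_φ_self (S : Structure m N) {p : N} (u : TangentSpace (𝓡 m) p) :
    S.g.inner p u (S.φ p u) = 0 := (S.isContactMetric p).inner_φ_self u

end Curves

/-! ### Frenet expansion of ∇_T³T. -/

section FrenetCurves

variable {m : ℕ} {N : Type*} [TopologicalSpace N]
  [ChartedSpace (EuclideanSpace ℝ (Fin m)) N] [IsManifold (𝓡 m) ∞ N]

/-- The `i`-th curvature, extended by zero beyond the osculating order. -/
def extCurvature (r : ℕ) (κ : ℕ → ℝ → ℝ) (i : ℕ) (t : ℝ) : ℝ := if i < r then κ i t else 0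

/-- The `i`-th Frenet field, extended by zero beyond the osculating order. -/
def extFrame {γ : ℝ → N} (r : ℕ) (E : ℕ → ∀ t, TangentSpace (𝓡 m) (γ t)) (i : ℕ) (t : ℝ) :
    TangentSpace (𝓡 m) (γ t) := if i ≤ r then E i t else 0

namespace IsFrenetCurve

variable {g : Metric m N} {J : Set ℝ} {γ : ℝ → N} {r : ℕ}
  {E : ℕ → ∀ t, TangentSpace (𝓡 m) (γ t)} {κ : ℕ → ℝ → ℝ}
  (h : IsFrenetCurve g J γ r E κ)

omit [IsManifold (𝓡 m) ∞ N] in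
theorem extFrame_of_le {i : ℕ} (hi : i ≤ r) (t : ℝ) : extFrame r E i t = E i t := if_pos hi

omit [IsManifold (𝓡 m) ∞ N] in
theorem extFrame_of_lt {i : ℕ} (hi : r < i) (t : ℝ) : extFrame r E i t = 0 :=
  if_neg (not_le.2 hi)

theorem extCurvature_of_lt {i : ℕ} (hi : i < r) (t : ℝ) : extCurvature r κ i t = κ i t :=
  if_pos hi

theorem extCurvature_of_le {i : ℕ} (hi : r ≤ i) (t : ℝ) : extCurvature r κ i t = 0 :=
  if_neg (not_lt.2 hi)

include h

theorem mdifferentiableAt (hJ : IsOpen J) {t : ℝ} (ht : t ∈ J) :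
    MDifferentiableAt 𝓘(ℝ, ℝ) (𝓡 m) γ t :=
  (h.smooth_curve.contMDiffAt (hJ.mem_nhds ht)).mdifferentiableAt (by simp)

theorem differentiableAlong_extFrame (hJ : IsOpen J) {t : ℝ} (ht : t ∈ J) {i : ℕ} (hi : 1 ≤ i) :
    DifferentiableAlong γ (extFrame r E i) t := by
  by_cases hir : i ≤ r
  · have e : extFrame r E i = E i := funext (extFrame_of_le hir)
    rw [e]
    exact differentiableAlong_of_contMDiffAt
      ((h.smooth_frame i hi hir).contMDiffAt (hJ.mem_nhds ht))
  · have e : extFrame r E i = fun t => 0 := funext (extFrame_of_lt (not_le.1 hir))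
    rw [e]
    simp only [DifferentiableAlong, coords_zero]
    exact differentiableAt_const 0

theorem contDiffAt_extCurvature (hJ : IsOpen J) {t : ℝ} (ht : t ∈ J) {i : ℕ} (hi : 1 ≤ i) :
    ContDiffAt ℝ ∞ (extCurvature r κ i) t := by
  by_cases hir : i < r
  · have e : extCurvature r κ i = κ i := funext (extCurvature_of_lt hir)
    rw [e]
    exact (h.smooth_curvature i hi hir).contDiffAt (hJ.mem_nhds ht)
  · have e : extCurvature r κ i = fun t => 0 := funext (extCurvature_of_le (not_lt.1 hir))
    rw [e]
    exact contDiffAt_const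

theorem differentiableAt_extCurvature (hJ : IsOpen J) {t : ℝ} (ht : t ∈ J) {i : ℕ} (hi : 1 ≤ i) :
    DifferentiableAt ℝ (extCurvature r κ i) t :=
  (h.contDiffAt_extCurvature hJ ht hi).differentiableAt (by simp)

theorem extCurvature_nonneg {t : ℝ} (ht : t ∈ J) {i : ℕ} (hi : 1 ≤ i) :
    0 ≤ extCurvature r κ i t := by
  by_cases hir : i < r
  · rw [extCurvature_of_lt hir]; exact (h.curvature_pos t ht i hi hir).le
  · rw [extCurvature_of_le (not_lt.1 hir)]

theorem extCurvature_pos {t : ℝ} (ht : t ∈ J) {i : ℕ} (hi : 1 ≤ i) (hir : i < r) :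
    0 < extCurvature r κ i t := by
  rw [extCurvature_of_lt hir]; exact h.curvature_pos t ht i hi hir

theorem inner_extFrame {t : ℝ} (ht : t ∈ J) {i j : ℕ} (hi : 1 ≤ i) (hj : 1 ≤ j) (hij : i ≠ j) :
    g.inner (γ t) (extFrame r E i t) (extFrame r E j t) = 0 := by
  by_cases hir : i ≤ r
  · by_cases hjr : j ≤ r
    · rw [extFrame_of_le hir, extFrame_of_le hjr, h.orthonormal t ht i j hi hir hj hjr, if_neg hij]
    · rw [extFrame_of_lt (not_le.1 hjr), map_zero]
  · rw [extFrame_of_lt (not_le.1 hir), map_zero, zero_apply]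

theorem inner_extFrame_self {t : ℝ} (ht : t ∈ J) {i : ℕ} (hi : 1 ≤ i) (hir : i ≤ r) :
    g.inner (γ t) (extFrame r E i t) (extFrame r E i t) = 1 := by
  rw [extFrame_of_le hir, h.orthonormal t ht i i hi hir hi hir, if_pos rfl]

theorem extFrame_one {t : ℝ} (ht : t ∈ J) : extFrame r E 1 t = velocity γ t := by
  rw [extFrame_of_le h.one_le, h.frame_one t ht]

theorem covDeriv_extFrame_one {t : ℝ} (ht : t ∈ J) : covDeriv g γ (extFrame r E 1) t
    = extCurvature r κ 1 t • extFrame r E 2 t := by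
  have e : extFrame r E 1 = E 1 := funext (extFrame_of_le h.one_le)
  rw [e, h.frenet t ht 1 le_rfl h.one_le, if_neg (lt_irrefl 1), zero_add]
  by_cases hr : 1 < r
  · rw [if_pos hr, extCurvature_of_lt hr, extFrame_of_le hr]
  · rw [if_neg hr, extCurvature_of_le (not_lt.1 hr), zero_smul]

theorem covDeriv_extFrame_succ {t : ℝ} (ht : t ∈ J) {i : ℕ} (hi : 1 ≤ i) (hir : i + 1 ≤ r) :
    covDeriv g γ (extFrame r E (i + 1)) t = -extCurvature r κ i t • extFrame r E i t
      + extCurvature r κ (i + 1) t • extFrame r E (i + 2) t := by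
  have e : extFrame r E (i + 1) = E (i + 1) := funext (extFrame_of_le hir)
  rw [e, h.frenet t ht (i + 1) (by omega) hir, if_pos (by omega), Nat.add_sub_cancel,
    extCurvature_of_lt (show i < r by omega), extFrame_of_le (show i ≤ r by omega)]
  by_cases hr : i + 1 < r
  · rw [if_pos hr, extCurvature_of_lt hr, extFrame_of_le (show i + 2 ≤ r by omega)]
  · rw [if_neg hr, extCurvature_of_le (not_lt.1 hr), zero_smul]

/-- The factor κ_i vanishes for i ≥ r, so this form of the Frenet equation needs no bound on `i` and
keeps the expansions uniform in `r`. -/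
theorem smul_covDeriv_extFrame_succ {t : ℝ} (ht : t ∈ J) {i : ℕ} (hi : 1 ≤ i) :
    extCurvature r κ i t • covDeriv g γ (extFrame r E (i + 1)) t
      = extCurvature r κ i t • (-extCurvature r κ i t • extFrame r E i t
      + extCurvature r κ (i + 1) t • extFrame r E (i + 2) t) := by
  by_cases hr : i + 1 ≤ r
  · rw [h.covDeriv_extFrame_succ ht hi hr]
  · rw [extCurvature_of_le (show r ≤ i by omega), zero_smul, zero_smul]

theorem tension_eq (hJ : IsOpen J) {t : ℝ} (ht : t ∈ J) : tension g γ t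
    = extCurvature r κ 1 t • extFrame r E 2 t := by
  rw [tension, ← h.covDeriv_extFrame_one ht]
  refine covDeriv_congr g ?_
  filter_upwards [hJ.mem_nhds ht] with s hs
  exact (h.extFrame_one hs).symm

theorem covDeriv_tension_eq (hJ : IsOpen J) {t : ℝ} (ht : t ∈ J) :
    covDeriv g γ (tension g γ) t = (-extCurvature r κ 1 t ^ 2) • extFrame r E 1 t
      + deriv (extCurvature r κ 1) t • extFrame r E 2 t
      + (extCurvature r κ 1 t * extCurvature r κ 2 t) • extFrame r E 3 t := by
  have e : covDeriv g γ (tension g γ) t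
      = covDeriv g γ (fun s => extCurvature r κ 1 s • extFrame r E 2 s) t := by
    refine covDeriv_congr g ?_
    filter_upwards [hJ.mem_nhds ht] with s hs
    exact h.tension_eq hJ hs
  have e2 : extCurvature r κ 1 t • covDeriv g γ (extFrame r E 2) t = extCurvature r κ 1 t •
      (-extCurvature r κ 1 t • extFrame r E 1 t + extCurvature r κ 2 t • extFrame r E 3 t) :=
    h.smul_covDeriv_extFrame_succ ht le_rfl
  rw [e, covDeriv_smul g (h.differentiableAt_extCurvature hJ ht le_rfl)
    (h.differentiableAlong_extFrame hJ ht one_le_two), e2]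
  module

theorem covDeriv_covDeriv_tension_eq (hJ : IsOpen J) {t : ℝ} (ht : t ∈ J) :
    covDeriv g γ (covDeriv g γ (tension g γ)) t
      = (-3 * extCurvature r κ 1 t * deriv (extCurvature r κ 1) t) • extFrame r E 1 t
      + (deriv (deriv (extCurvature r κ 1)) t - extCurvature r κ 1 t ^ 3
        - extCurvature r κ 1 t * extCurvature r κ 2 t ^ 2) • extFrame r E 2 t
      + (2 * deriv (extCurvature r κ 1) t * extCurvature r κ 2 t
        + extCurvature r κ 1 t * deriv (extCurvature r κ 2) t) • extFrame r E 3 t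
      + (extCurvature r κ 1 t * extCurvature r κ 2 t * extCurvature r κ 3 t)
        • extFrame r E 4 t := by
  have e : covDeriv g γ (covDeriv g γ (tension g γ)) t
      = covDeriv g γ (fun t => (-extCurvature r κ 1 t ^ 2) • extFrame r E 1 t
      + deriv (extCurvature r κ 1) t • extFrame r E 2 t
      + (extCurvature r κ 1 t * extCurvature r κ 2 t) • extFrame r E 3 t) t := by
    refine covDeriv_congr g ?_
    filter_upwards [hJ.mem_nhds ht] with s hs
    exact h.covDeriv_tension_eq hJ hs
  have k1 := h.differentiableAt_extCurvature hJ ht (i := 1) le_rfl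
  have k2 := h.differentiableAt_extCurvature hJ ht (i := 2) one_le_two
  have k1' : DifferentiableAt ℝ (deriv (extCurvature r κ 1)) t :=
    (((h.contDiffAt_extCurvature hJ ht (i := 1) le_rfl).fderiv_right (m := ∞)
      le_rfl).differentiableAt (by simp)).clm_apply (differentiableAt_const 1)
  have d1 := h.differentiableAlong_extFrame hJ ht (i := 1) le_rfl
  have d2 := h.differentiableAlong_extFrame hJ ht (i := 2) one_le_two
  have d3 := h.differentiableAlong_extFrame hJ ht (i := 3) (by norm_num)
  have k1sq : DifferentiableAt ℝ (fun t => -extCurvature r κ 1 t ^ 2) t := (k1.fun_pow 2).fun_neg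
  have k12 : DifferentiableAt ℝ (fun t => extCurvature r κ 1 t * extCurvature r κ 2 t) t :=
    k1.fun_mul k2
  have e1 : deriv (fun t => -extCurvature r κ 1 t ^ 2) t
      = -(2 * extCurvature r κ 1 t * deriv (extCurvature r κ 1) t) := by
    rw [deriv.fun_neg, deriv_fun_pow k1]; simp
  have e2 : deriv (fun t => extCurvature r κ 1 t * extCurvature r κ 2 t) t
      = deriv (extCurvature r κ 1) t * extCurvature r κ 2 t
        + extCurvature r κ 1 t * deriv (extCurvature r κ 2) t := deriv_fun_mul k1 k2
  have e3 : extCurvature r κ 2 t • covDeriv g γ (extFrame r E 3) t = extCurvature r κ 2 t •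
      (-extCurvature r κ 2 t • extFrame r E 2 t + extCurvature r κ 3 t • extFrame r E 4 t) :=
    h.smul_covDeriv_extFrame_succ ht one_le_two
  rw [e, covDeriv_add g ((d1.smul k1sq).add (d2.smul k1')) (d3.smul k12),
    covDeriv_add g (d1.smul k1sq) (d2.smul k1'), covDeriv_smul g k1sq d1, covDeriv_smul g k1' d2,
    covDeriv_smul g k12 d3, e1, e2, mul_smul _ _ (covDeriv g γ (extFrame r E 3) t), e3,
    h.covDeriv_extFrame_one ht]
  -- The derivative of E₂ appears here also with the coefficient κ₁' instead of κ₁, so the case r =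
  -- 1 is separated; there κ₁ and κ₂ vanish identically.
  by_cases hr : 2 ≤ r
  · have e4 : covDeriv g γ (extFrame r E 2) t = -extCurvature r κ 1 t • extFrame r E 1 t
        + extCurvature r κ 2 t • extFrame r E 3 t := h.covDeriv_extFrame_succ ht le_rfl hr
    rw [e4]
    module
  · have hk : extCurvature r κ 1 = fun _ => 0 := funext (extCurvature_of_le (by omega))
    have hk2 : extCurvature r κ 2 = fun _ => 0 := funext (extCurvature_of_le (by omega))
    simp [hk, hk2]

end IsFrenetCurve

end FrenetCurves

/-- A function with zero derivative on an open interval is constant there. -/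
theorem eq_of_hasDerivAt_zero {J : Set ℝ} (hJ : IsOpen J) (hJ' : J.OrdConnected) {f : ℝ → ℝ}
    (hf : ∀ t ∈ J, HasDerivAt f 0 t) {s t : ℝ} (hs : s ∈ J) (ht : t ∈ J) : f s = f t :=
  hJ.is_const_of_deriv_eq_zero hJ'.isPreconnected
    (fun x hx => (hf x hx).differentiableAt.differentiableWithinAt) (fun x hx => (hf x hx).deriv)
    hs ht

/-! ### The biharmonic equation for Legendre Frenet curves. -/

section LegendreFrenetCurves

variable {m : ℕ} {N : Type*} [TopologicalSpace N]
  [ChartedSpace (EuclideanSpace ℝ (Fin m)) N] [IsManifold (𝓡 m) ∞ N]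

namespace IsFrenetCurve

variable {S : Structure m N} {c : ℝ} {J : Set ℝ} {γ : ℝ → N} {r : ℕ}
  {E : ℕ → ∀ t, TangentSpace (𝓡 m) (γ t)} {κ : ℕ → ℝ → ℝ}
  (h : IsFrenetCurve S.g J γ r E κ) (hL : S.IsLegendre J γ) (hJ : IsOpen J)
include h hL hJ

/-- Differentiating g(T, ξ) = 0 gives κ₁ η(E₂) - g(T, φT) = 0, where the last term is zero and κ₁ >
0. -/
theorem η_extFrame_two (hr : 2 ≤ r) {t : ℝ} (ht : t ∈ J) :
    S.η (γ t) (extFrame r E 2 t) = 0 := by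
  have hγ := h.mdifferentiableAt hJ ht
  have e1 := hasDerivAt_inner S.g hγ (h.differentiableAlong_extFrame hJ ht (i := 1) le_rfl)
    (differentiableAlong_ξ S hγ)
  have e2 : HasDerivAt (fun s => S.g.inner (γ s) (extFrame r E 1 s) (S.ξ (γ s))) 0 t := by
    refine (hasDerivAt_const t (0 : ℝ)).congr_of_eventuallyEq ?_
    filter_upwards [hJ.mem_nhds ht] with s hs
    rw [S.inner_ξ, h.extFrame_one hs, hL s hs]
  have e3 := e1.unique e2
  rw [h.covDeriv_extFrame_one ht, covDeriv_ξ S hγ, h.extFrame_one ht, map_neg, S.inner_φ_self,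
    S.inner_ξ, map_smul, neg_zero, add_zero, smul_eq_mul] at e3
  exact (mul_eq_zero.1 e3).resolve_left (h.extCurvature_pos ht le_rfl hr).ne'

/-- As γ is Legendre, ∇_T(φT) = ξ + κ₁ φE₂, which is orthogonal to E₂; the T-component of ∇_T E₂ is
orthogonal to φT. -/
theorem hasDerivAt_inner_φ (hr : 2 ≤ r) {t : ℝ} (ht : t ∈ J) :
    HasDerivAt (fun s => S.g.inner (γ s) (extFrame r E 2 s) (S.φ (γ s) (velocity γ s)))
      (extCurvature r κ 2 t * S.g.inner (γ t) (extFrame r E 3 t) (S.φ (γ t) (velocity γ t))) t := by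
  have hγ := h.mdifferentiableAt hJ ht
  have d1 := h.differentiableAlong_extFrame hJ ht (i := 1) le_rfl
  have e1 := hasDerivAt_inner S.g hγ (h.differentiableAlong_extFrame hJ ht (i := 2) one_le_two)
    (d1.φ S hγ)
  refine (e1.congr_of_eventuallyEq ?_).congr_deriv ?_
  · filter_upwards [hJ.mem_nhds ht] with s hs
    rw [h.extFrame_one hs]
  · have e2 : covDeriv S.g γ (extFrame r E 2) t = -extCurvature r κ 1 t • extFrame r E 1 t
        + extCurvature r κ 2 t • extFrame r E 3 t := h.covDeriv_extFrame_succ ht le_rfl hr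
    rw [e2, covDeriv_φ S hγ d1, h.covDeriv_extFrame_one ht, h.extFrame_one ht, hL t ht]
    simp only [map_add, map_smul, add_apply, smul_apply, smul_eq_mul, zero_smul, sub_zero,
      S.inner_ξ, S.inner_φ_self, h.η_extFrame_two hL hJ hr ht, mul_zero, zero_add, add_zero]

theorem bitension_eq (hS : S.IsSpaceForm c) (hr : 2 ≤ r) {t : ℝ} (ht : t ∈ J) :
    bitension S.g γ t
      = (-3 * extCurvature r κ 1 t * deriv (extCurvature r κ 1) t) • extFrame r E 1 t
      + (deriv (deriv (extCurvature r κ 1)) t - extCurvature r κ 1 t ^ 3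
        - extCurvature r κ 1 t * extCurvature r κ 2 t ^ 2
        + (c + 3) / 4 * extCurvature r κ 1 t) • extFrame r E 2 t
      + (2 * deriv (extCurvature r κ 1) t * extCurvature r κ 2 t
        + extCurvature r κ 1 t * deriv (extCurvature r κ 2) t) • extFrame r E 3 t
      + (extCurvature r κ 1 t * extCurvature r κ 2 t * extCurvature r κ 3 t)
        • extFrame r E 4 t
      + (extCurvature r κ 1 t * (3 * (c - 1) / 4
          * S.g.inner (γ t) (extFrame r E 2 t) (S.φ (γ t) (velocity γ t))))
        • S.φ (γ t) (velocity γ t) := by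
  have h11 := h.inner_extFrame_self ht (i := 1) le_rfl h.one_le
  have h12 := h.inner_extFrame ht (i := 1) (j := 2) le_rfl one_le_two (by norm_num)
  rw [h.extFrame_one ht] at h11 h12
  rw [bitension, h.covDeriv_covDeriv_tension_eq hJ ht, h.tension_eq hJ ht, curvature_smul,
    hS.curvature_eq (hL t ht) (h.η_extFrame_two hL hJ hr ht) h11 h12]
  module

/-- The components of the biharmonic equation. -/
theorem curvatures_of_isBiharmonic (hS : S.IsSpaceForm c) (hr : 2 ≤ r)
    (hb : IsBiharmonic S.g J γ) {t : ℝ} (ht : t ∈ J) :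
    deriv (extCurvature r κ 1) t = 0 ∧
    extCurvature r κ 1 t ^ 2 + extCurvature r κ 2 t ^ 2 = (c + 3) / 4 + 3 * (c - 1) / 4
      * S.g.inner (γ t) (extFrame r E 2 t) (S.φ (γ t) (velocity γ t)) ^ 2 ∧
    deriv (extCurvature r κ 2) t = -(3 * (c - 1) / 4
      * S.g.inner (γ t) (extFrame r E 2 t) (S.φ (γ t) (velocity γ t))
      * S.g.inner (γ t) (extFrame r E 3 t) (S.φ (γ t) (velocity γ t))) ∧
    (extCurvature r κ 2 t * extCurvature r κ 3 t) • extFrame r E 4 t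
      - (3 * (c - 1) / 4 * S.g.inner (γ t) (extFrame r E 2 t) (S.φ (γ t) (velocity γ t)) ^ 2)
        • extFrame r E 2 t
      + deriv (extCurvature r κ 2) t • extFrame r E 3 t
      + (3 * (c - 1) / 4 * S.g.inner (γ t) (extFrame r E 2 t) (S.φ (γ t) (velocity γ t)))
        • S.φ (γ t) (velocity γ t) = 0 := by
  have o := fun i j hi hj hij => h.inner_extFrame ht (i := i) (j := j) hi hj hij
  have hk1 : ∀ t ∈ J, deriv (extCurvature r κ 1) t = 0 := by
    intro t ht
    have o := fun i j hi hj hij => h.inner_extFrame ht (i := i) (j := j) hi hj hij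
    have k1 := h.extCurvature_pos ht le_rfl hr
    have e := congrArg (S.g.inner (γ t) (extFrame r E 1 t)) (hb t ht)
    rw [h.bitension_eq hL hJ hS hr ht] at e
    simp only [map_add, map_smul, smul_eq_mul, h.inner_extFrame_self ht le_rfl h.one_le,
      o 1 2 le_rfl (by norm_num) (by norm_num), o 1 3 le_rfl (by norm_num) (by norm_num),
      o 1 4 le_rfl (by norm_num) (by norm_num), map_zero, mul_zero, mul_one, add_zero] at e
    rw [h.extFrame_one ht, S.inner_φ_self, mul_zero, add_zero] at e
    rcases mul_eq_zero.1 e with e | e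
    · linarith
    · exact e
  have hk1' : deriv (deriv (extCurvature r κ 1)) t = 0 := by
    have : deriv (extCurvature r κ 1) =ᶠ[nhds t] fun _ => 0 := by
      filter_upwards [hJ.mem_nhds ht] with s hs using hk1 s hs
    rw [this.deriv_eq]; simp
  have k1 := h.extCurvature_pos ht le_rfl hr
  have hb' := hb t ht
  rw [h.bitension_eq hL hJ hS hr ht, hk1 t ht, hk1'] at hb'
  have e2 := congrArg (S.g.inner (γ t) (extFrame r E 2 t)) hb'
  simp only [map_add, map_smul, smul_eq_mul, h.inner_extFrame_self ht one_le_two hr,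
      o 2 1 (by norm_num) (by norm_num) (by norm_num),
      o 2 3 (by norm_num) (by norm_num) (by norm_num),
      o 2 4 (by norm_num) (by norm_num) (by norm_num), map_zero, mul_zero, mul_one, add_zero,
      zero_add, zero_mul] at e2
  have e2' : extCurvature r κ 1 t ^ 2 + extCurvature r κ 2 t ^ 2 = (c + 3) / 4 + 3 * (c - 1) / 4
      * S.g.inner (γ t) (extFrame r E 2 t) (S.φ (γ t) (velocity γ t)) ^ 2 := by
    have : extCurvature r κ 1 t * (extCurvature r κ 1 t ^ 2 + extCurvature r κ 2 t ^ 2)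
      = extCurvature r κ 1 t * ((c + 3) / 4 + 3 * (c - 1) / 4
      * S.g.inner (γ t) (extFrame r E 2 t) (S.φ (γ t) (velocity γ t)) ^ 2) := by
        linear_combination (-1) * e2
    exact mul_left_cancel₀ k1.ne' this
  refine ⟨hk1 t ht, e2', ?_, ?_⟩
  -- For r = 2 there is no E₃ to pair with, and both sides vanish by the zero extension.
  · by_cases hr3 : 3 ≤ r
    · have e3 := congrArg (S.g.inner (γ t) (extFrame r E 3 t)) hb'
      simp only [map_add, map_smul, smul_eq_mul, h.inner_extFrame_self ht (by norm_num) hr3,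
        o 3 1 (by norm_num) (by norm_num) (by norm_num),
        o 3 2 (by norm_num) (by norm_num) (by norm_num),
        o 3 4 (by norm_num) (by norm_num) (by norm_num), map_zero, mul_zero, mul_one, add_zero,
        zero_add, zero_mul] at e3
      apply mul_left_cancel₀ k1.ne'
      linear_combination e3
    · have e : extCurvature r κ 2 = fun _ => 0 := funext (extCurvature_of_le (by omega))
      rw [e, extFrame_of_lt (show r < 3 by omega)]
      simp
  -- The full equation divided by κ₁, with the coefficient of E₂ rewritten by the E₂-component
  -- `e2'`.
  · apply smul_right_injective _ k1.ne'
    change _ • _ = _ • (0 : TangentSpace (𝓡 m) (γ t))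
    rw [smul_zero, ← hb']
    have : -extCurvature r κ 1 t ^ 3 - extCurvature r κ 1 t * extCurvature r κ 2 t ^ 2
        + (c + 3) / 4 * extCurvature r κ 1 t = -extCurvature r κ 1 t * (3 * (c - 1) / 4
      * S.g.inner (γ t) (extFrame r E 2 t) (S.φ (γ t) (velocity γ t)) ^ 2) := by
      linear_combination (-extCurvature r κ 1 t) * e2'
    rw [zero_sub, this]
    module

/-- For a biharmonic curve, `g(E₂, φT)` is constant. -/
theorem inner_φ_const_of_isBiharmonic (hS : S.IsSpaceForm c) (hc : c ≠ 1) (hJ' : J.OrdConnected)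
    (hr : 2 ≤ r) (hb : IsBiharmonic S.g J γ) {s t : ℝ} (hs : s ∈ J) (ht : t ∈ J) :
    S.g.inner (γ s) (extFrame r E 2 s) (S.φ (γ s) (velocity γ s))
      = S.g.inner (γ t) (extFrame r E 2 t) (S.φ (γ t) (velocity γ t)) := by
  set f : ℝ → ℝ := fun s => S.g.inner (γ s) (extFrame r E 2 s) (S.φ (γ s) (velocity γ s)) with hf
  have hc' : 3 * (c - 1) / 4 ≠ 0 := by
    intro h0; exact hc (by linarith)
  -- With A = 3(c-1)/4, differentiating κ₁² + κ₂² = (c+3)/4 + A f² gives 2κ₂κ₂' = 2A f f'. The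
  -- E₃-component together with f' = κ₂ g(E₃, φT) gives 2κ₂κ₂' = -2A f f'. Hence 4A f f' = 0.
  have hff : ∀ t ∈ J, f t * deriv f t = 0 := by
    intro t ht
    obtain ⟨a1, a2, a3, -⟩ := h.curvatures_of_isBiharmonic hL hJ hS hr hb ht
    have d1 := (h.differentiableAt_extCurvature hJ ht (i := 1) le_rfl).hasDerivAt
    have d2 := (h.differentiableAt_extCurvature hJ ht (i := 2) one_le_two).hasDerivAt
    have df := h.hasDerivAt_inner_φ hL hJ hr ht
    have e1 := ((d1.fun_pow 2).fun_add (d2.fun_pow 2))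
    have e2 := (((df.fun_pow 2).const_mul (3 * (c - 1) / 4)).const_add
        ((c + 3) / 4)).congr_of_eventuallyEq
        (f₁ := fun t => extCurvature r κ 1 t ^ 2 + extCurvature r κ 2 t ^ 2) (by
      filter_upwards [hJ.mem_nhds ht] with s hs
      exact (h.curvatures_of_isBiharmonic hL hJ hS hr hb hs).2.1)
    have e3 := e1.unique e2
    rw [a1, a3] at e3
    rw [df.deriv]
    apply mul_left_cancel₀ hc'
    simp only [hf]
    simp only [Nat.cast_ofNat, Nat.add_one_sub_one, pow_one, mul_zero, zero_add] at e3
    linear_combination (-1 / 4) * e3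
  have hsq : ∀ s ∈ J, ∀ t ∈ J, f s ^ 2 = f t ^ 2 := by
    intro s hs t ht
    refine eq_of_hasDerivAt_zero hJ hJ' (f := fun t => f t ^ 2) (fun t ht => ?_) hs ht
    have df := (h.hasDerivAt_inner_φ hL hJ hr ht).differentiableAt.hasDerivAt
    refine (df.fun_pow 2).congr_deriv ?_
    have := hff t ht
    simp only [Nat.cast_ofNat, Nat.add_one_sub_one, pow_one]
    linear_combination 2 * this
  change f s = f t
  -- Constancy of f² means that f either vanishes identically or has no zero; in the second case f
  -- f' = 0 yields f' = 0.
  by_cases h0 : f s = 0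
  · have := hsq t ht s hs
    rw [h0] at this ⊢
    rw [eq_comm, ← sq_eq_zero_iff, this]; simp
  · refine eq_of_hasDerivAt_zero hJ hJ' (f := f) (fun t ht => ?_) hs ht
    have df := (h.hasDerivAt_inner_φ hL hJ hr ht).differentiableAt.hasDerivAt
    refine df.congr_deriv ((mul_eq_zero.1 (hff t ht)).resolve_left fun h1 => h0 ?_)
    have := hsq s hs t ht
    rw [h1] at this
    rw [← sq_eq_zero_iff, this]; simp

end IsFrenetCurve

end LegendreFrenetCurves

/-- A point of the unit circle off the axes has an angle in `(0, 2π)` off the axes. -/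
theorem exists_angle {a b : ℝ} (ha : a ≠ 0) (hb : b ≠ 0) (hab : a ^ 2 + b ^ 2 = 1) :
    ∃ α ∈ Set.Ioo 0 (2 * Real.pi) \ {Real.pi / 2, Real.pi, 3 * Real.pi / 2},
      Real.cos α = a ∧ Real.sin α = b := by
  have hpi := Real.pi_pos
  obtain ⟨α, hα, h1, h2⟩ : ∃ α ∈ Set.Ioo 0 (2 * Real.pi), Real.cos α = a ∧ Real.sin α = b := by
    have hz : ‖(⟨a, b⟩ : ℂ)‖ = 1 := by
      rw [Complex.norm_def, Complex.normSq_mk, ← sq, ← sq, hab, Real.sqrt_one]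
    have hz0 : (⟨a, b⟩ : ℂ) ≠ 0 := by
      rw [← norm_ne_zero_iff, hz]; norm_num
    have hc : Real.cos (Complex.arg ⟨a, b⟩) = a := by
      rw [Complex.cos_arg hz0, hz, div_one]
    have hs : Real.sin (Complex.arg ⟨a, b⟩) = b := by
      rw [Complex.sin_arg, hz, div_one]
    have b1 := Complex.neg_pi_lt_arg ⟨a, b⟩
    have b2 := Complex.arg_le_pi ⟨a, b⟩
    rcases lt_trichotomy (Complex.arg ⟨a, b⟩) 0 with h0 | h0 | h0
    · exact ⟨Complex.arg ⟨a, b⟩ + 2 * Real.pi, ⟨by linarith, by linarith⟩,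
        by rw [Real.cos_add_two_pi, hc], by rw [Real.sin_add_two_pi, hs]⟩
    · rw [h0, Real.sin_zero] at hs
      exact absurd hs.symm hb
    · exact ⟨Complex.arg ⟨a, b⟩, ⟨h0, by linarith⟩, hc, hs⟩
  refine ⟨α, ⟨hα, ?_⟩, h1, h2⟩
  rintro (h | h | h)
  · rw [h, Real.cos_pi_div_two] at h1; exact ha h1.symm
  · rw [h, Real.sin_pi] at h2; exact hb h2.symm
  · rw [Set.mem_singleton_iff] at h
    rw [h, show 3 * Real.pi / 2 = Real.pi / 2 + Real.pi by ring, Real.cos_add_pi,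
      Real.cos_pi_div_two, neg_zero] at h1
    exact ha h1.symm

/-! ### Geodesics, and the shape of biharmonic Legendre curves. -/

section LegendreFrenetCurves

variable {m : ℕ} {N : Type*} [TopologicalSpace N]
  [ChartedSpace (EuclideanSpace ℝ (Fin m)) N] [IsManifold (𝓡 m) ∞ N]

theorem IsGeodesic.isBiharmonic {g : Metric m N} {J : Set ℝ} (hJ : IsOpen J) {γ : ℝ → N}
    (hg : IsGeodesic g J γ) : IsBiharmonic g J γ := by
  intro t ht
  have e1 : ∀ t ∈ J, covDeriv g γ (tension g γ) t = 0 := by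
    intro t ht
    rw [← covDeriv_zero (γ := γ) (t := t) g]
    refine covDeriv_congr g ?_
    filter_upwards [hJ.mem_nhds ht] with s hs using hg s hs
  have e2 : covDeriv g γ (covDeriv g γ (tension g γ)) t = 0 := by
    rw [← covDeriv_zero (γ := γ) (t := t) g]
    refine covDeriv_congr g ?_
    filter_upwards [hJ.mem_nhds ht] with s hs using e1 s hs
  have e3 : tension g γ t = 0 := hg t ht
  have e4 := curvature_smul g 0 (velocity γ t) (0 : TangentSpace (𝓡 m) (γ t)) (velocity γ t)
  rw [zero_smul, zero_smul] at e4
  rw [bitension, e2, e3, e4, sub_zero]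

namespace IsFrenetCurve

variable {S : Structure m N} {c : ℝ} {J : Set ℝ} {γ : ℝ → N} {r : ℕ}
  {E : ℕ → ∀ t, TangentSpace (𝓡 m) (γ t)} {κ : ℕ → ℝ → ℝ}

theorem isGeodesic_of_order_one {g : Metric m N} (h : IsFrenetCurve g J γ r E κ) (hJ : IsOpen J)
    (hr : r < 2) : IsGeodesic g J γ := by
  intro t ht
  have e := h.tension_eq hJ ht
  rwa [extCurvature_of_le (by omega), zero_smul] at e

theorem not_isGeodesic {g : Metric m N} (h : IsFrenetCurve g J γ r E κ) (hJ : IsOpen J)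
    (hJ'' : J.Nonempty) (hr : 2 ≤ r) : ¬ IsGeodesic g J γ := by
  intro hg
  obtain ⟨t, ht⟩ := hJ''
  have e := h.tension_eq hJ ht
  rw [show tension g γ t = 0 from hg t ht] at e
  have e1 := congrArg (g.inner (γ t) (extFrame r E 2 t)) e
  rw [map_zero, map_smul, h.inner_extFrame_self ht one_le_two hr, smul_eq_mul, mul_one] at e1
  exact (h.extCurvature_pos ht le_rfl hr).ne e1

/-- The shape of the biharmonic Legendre curves for which `g(E₂, φT)` is none of the constant
functions `0`, `1`, `-1`. -/
theorem exists_of_isBiharmonic (h : IsFrenetCurve S.g J γ r E κ) (hL : S.IsLegendre J γ)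
    (hJ : IsOpen J) (hS : S.IsSpaceForm c) (hc : c ≠ 1) (hJ' : J.OrdConnected)
    (hJ'' : J.Nonempty) (hr : 2 ≤ r)
    (h0 : ¬ ∀ t ∈ J, S.g.inner (γ t) (E 2 t) (S.φ (γ t) (velocity γ t)) = 0)
    (h1 : ¬ ∀ t ∈ J, S.g.inner (γ t) (E 2 t) (S.φ (γ t) (velocity γ t)) = 1)
    (h2 : ¬ ∀ t ∈ J, S.g.inner (γ t) (E 2 t) (S.φ (γ t) (velocity γ t)) = -1)
    (hb : IsBiharmonic S.g J γ) :
    4 ≤ r ∧ ∃ a b : ℝ, a ≠ 0 ∧ b ≠ 0 ∧ a ^ 2 + b ^ 2 = 1 ∧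
      (∀ t ∈ J, S.φ (γ t) (velocity γ t) = a • E 2 t + b • E 4 t) ∧
      ∃ k₁ k₂ k₃ : ℝ, 0 < k₁ ∧ 0 < k₂ ∧ 0 < k₃ ∧
        (∀ t ∈ J, κ 1 t = k₁ ∧ κ 2 t = k₂ ∧ κ 3 t = k₃) ∧
        k₁ ^ 2 + k₂ ^ 2 = (c + 3) / 4 + 3 * (c - 1) / 4 * a ^ 2 ∧
        k₂ * k₃ = -(3 * (c - 1) / 4) * a * b := by
  obtain ⟨t₀, ht₀⟩ := hJ''
  have hA : 3 * (c - 1) / 4 ≠ 0 := by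
    intro h0; exact hc (by linarith)
  set A := 3 * (c - 1) / 4 with hAdef
  set a := S.g.inner (γ t₀) (extFrame r E 2 t₀) (S.φ (γ t₀) (velocity γ t₀)) with ha
  have hf : ∀ t ∈ J, S.g.inner (γ t) (extFrame r E 2 t) (S.φ (γ t) (velocity γ t)) = a :=
    fun t ht => h.inner_φ_const_of_isBiharmonic hL hJ hS hc hJ' hr hb ht ht₀
  have hf' : ∀ t ∈ J, S.g.inner (γ t) (E 2 t) (S.φ (γ t) (velocity γ t)) = a := by
    intro t ht
    rw [← hf t ht, extFrame_of_le hr]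
  have a0 : a ≠ 0 := fun e => h0 fun t ht => by rw [hf' t ht, e]
  have hk1 : ∀ t ∈ J, extCurvature r κ 1 t = extCurvature r κ 1 t₀ := by
    intro t ht
    refine eq_of_hasDerivAt_zero hJ hJ' (fun t ht => ?_) ht ht₀
    rw [← (h.curvatures_of_isBiharmonic hL hJ hS hr hb ht).1]
    exact (h.differentiableAt_extCurvature hJ ht le_rfl).hasDerivAt
  have hk12 : ∀ t ∈ J, extCurvature r κ 1 t ^ 2 + extCurvature r κ 2 t ^ 2
      = (c + 3) / 4 + A * a ^ 2 := by
    intro t ht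
    rw [← hf t ht]
    exact (h.curvatures_of_isBiharmonic hL hJ hS hr hb ht).2.1
  have hk2 : ∀ t ∈ J, extCurvature r κ 2 t = extCurvature r κ 2 t₀ := by
    intro t ht
    refine (pow_left_inj₀ (h.extCurvature_nonneg ht one_le_two)
      (h.extCurvature_nonneg ht₀ one_le_two) two_ne_zero).1 ?_
    have e1 := hk12 t ht
    have e2 := hk12 t₀ ht₀
    rw [hk1 t ht] at e1
    linarith
  have hk2' : ∀ t ∈ J, deriv (extCurvature r κ 2) t = 0 := by
    intro t ht
    have : extCurvature r κ 2 =ᶠ[nhds t] fun _ => extCurvature r κ 2 t₀ := by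
      filter_upwards [hJ.mem_nhds ht] with s hs using hk2 s hs
    rw [this.deriv_eq, deriv_const]
  -- With κ₂' = 0 the vector equation is linear in φT with coefficient A a ≠ 0, so it can be solved
  -- for φT.
  have hφ : ∀ t ∈ J, S.φ (γ t) (velocity γ t) = a • extFrame r E 2 t
      + (-(extCurvature r κ 2 t * extCurvature r κ 3 t) / (A * a)) • extFrame r E 4 t := by
    intro t ht
    have e := (h.curvatures_of_isBiharmonic hL hJ hS hr hb ht).2.2.2
    rw [hf t ht, hk2' t ht, zero_smul, add_zero] at e
    apply smul_right_injective _ (mul_ne_zero hA a0)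
    change (A * a) • _ = (A * a) • (_ + _)
    rw [smul_add, smul_smul, smul_smul, mul_div_cancel₀ _ (mul_ne_zero hA a0)]
    rw [add_comm] at e
    rw [eq_neg_of_add_eq_zero_left e]
    module
  have hnorm : ∀ t ∈ J, S.g.inner (γ t) (S.φ (γ t) (velocity γ t)) (S.φ (γ t) (velocity γ t))
      = 1 := by
    intro t ht
    rw [S.g_φ_φ, hL t ht, ← h.extFrame_one ht, h.inner_extFrame_self ht le_rfl h.one_le]
    ring
  -- Without E₄ the unit vector φT would be a E₂, so a = 1 or a = -1, both excluded.
  have hr4 : 4 ≤ r := by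
    by_contra hr4
    have e := hφ t₀ ht₀
    rw [extFrame_of_lt (not_le.1 hr4), smul_zero, add_zero] at e
    have e1 := hnorm t₀ ht₀
    rw [e, map_smul, map_smul, smul_apply, h.inner_extFrame_self ht₀ one_le_two hr, smul_eq_mul,
      smul_eq_mul, mul_one] at e1
    rcases mul_self_eq_one_iff.1 e1 with e1 | e1
    · exact h1 fun t ht => by rw [hf' t ht, e1]
    · exact h2 fun t ht => by rw [hf' t ht, e1]
  have p1 := fun t ht => h.extCurvature_pos (t := t) ht (i := 1) le_rfl (by omega)
  have p2 := fun t ht => h.extCurvature_pos (t := t) ht (i := 2) one_le_two (by omega)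
  have p3 := fun t ht => h.extCurvature_pos (t := t) ht (i := 3) (by norm_num) (by omega)
  have hab : ∀ t ∈ J, a ^ 2 + (-(extCurvature r κ 2 t * extCurvature r κ 3 t) / (A * a)) ^ 2
      = 1 := by
    intro t ht
    rw [← hnorm t ht]
    conv_rhs => rw [hφ t ht]
    simp only [map_add, map_smul, add_apply, smul_apply, smul_eq_mul,
      h.inner_extFrame_self ht (i := 2) one_le_two hr,
      h.inner_extFrame_self ht (i := 4) (by norm_num) hr4,
      h.inner_extFrame ht (i := 2) (j := 4) (by norm_num) (by norm_num) (by norm_num),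
      h.inner_extFrame ht (i := 4) (j := 2) (by norm_num) (by norm_num) (by norm_num)]
    ring
  -- The unit length of φT determines (κ₂κ₃)², hence κ₃, since κ₂ is a positive constant and κ₃ > 0.
  have hk3 : ∀ t ∈ J, extCurvature r κ 3 t = extCurvature r κ 3 t₀ := by
    intro t ht
    refine (pow_left_inj₀ (p3 t ht).le (p3 t₀ ht₀).le two_ne_zero).1 ?_
    have e1 := hab t ht
    rw [← hab t₀ ht₀, hk2 t ht, add_right_inj, div_pow, div_pow,
      div_left_inj' (pow_ne_zero 2 (mul_ne_zero hA a0)), neg_sq, neg_sq, mul_pow, mul_pow] at e1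
    exact mul_left_cancel₀ (pow_ne_zero 2 (p2 t₀ ht₀).ne') e1
  refine ⟨hr4, a, -(extCurvature r κ 2 t₀ * extCurvature r κ 3 t₀) / (A * a), a0, ?_, hab t₀ ht₀,
    ?_, extCurvature r κ 1 t₀, extCurvature r κ 2 t₀, extCurvature r κ 3 t₀, p1 t₀ ht₀, p2 t₀ ht₀,
    p3 t₀ ht₀, ?_, hk12 t₀ ht₀, ?_⟩
  · exact div_ne_zero (neg_ne_zero.2 (mul_pos (p2 t₀ ht₀) (p3 t₀ ht₀)).ne') (mul_ne_zero hA a0)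
  · intro t ht
    rw [hφ t ht, hk2 t ht, hk3 t ht, extFrame_of_le hr, extFrame_of_le hr4]
  · intro t ht
    rw [← hk1 t ht, ← hk2 t ht, ← hk3 t ht, extCurvature_of_lt (by omega),
      extCurvature_of_lt (by omega), extCurvature_of_lt (by omega)]
    exact ⟨rfl, rfl, rfl⟩
  · field_simp

/-- Legendre curves of the shape given by `exists_of_isBiharmonic` are biharmonic. -/
theorem isBiharmonic_of_φ_velocity_eq (h : IsFrenetCurve S.g J γ r E κ) (hL : S.IsLegendre J γ)
    (hJ : IsOpen J) (hS : S.IsSpaceForm c) (hr : 4 ≤ r) {a b k₁ k₂ k₃ : ℝ}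
    (hφ : ∀ t ∈ J, S.φ (γ t) (velocity γ t) = a • E 2 t + b • E 4 t)
    (hκ : ∀ t ∈ J, κ 1 t = k₁ ∧ κ 2 t = k₂ ∧ κ 3 t = k₃)
    (h12 : k₁ ^ 2 + k₂ ^ 2 = (c + 3) / 4 + 3 * (c - 1) / 4 * a ^ 2)
    (h23 : k₂ * k₃ = -(3 * (c - 1) / 4) * a * b) : IsBiharmonic S.g J γ := by
  have e1 : ∀ t ∈ J, extCurvature r κ 1 t = k₁ := fun t ht => by
    rw [extCurvature_of_lt (by omega), (hκ t ht).1]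
  have e2 : ∀ t ∈ J, extCurvature r κ 2 t = k₂ := fun t ht => by
    rw [extCurvature_of_lt (by omega), (hκ t ht).2.1]
  have e3 : ∀ t ∈ J, extCurvature r κ 3 t = k₃ := fun t ht => by
    rw [extCurvature_of_lt (by omega), (hκ t ht).2.2]
  have d : ∀ {f : ℝ → ℝ} {k : ℝ}, (∀ t ∈ J, f t = k) → ∀ t ∈ J, deriv f t = 0 := by
    intro f k hf t ht
    have : f =ᶠ[nhds t] fun _ => k := by
      filter_upwards [hJ.mem_nhds ht] with s hs using hf s hs
    rw [this.deriv_eq, deriv_const]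
  intro t ht
  have hf : S.g.inner (γ t) (extFrame r E 2 t) (S.φ (γ t) (velocity γ t)) = a := by
    have hφ' : S.φ (γ t) (velocity γ t) = a • extFrame r E 2 t + b • extFrame r E 4 t := by
      rw [hφ t ht, extFrame_of_le (show 2 ≤ r by omega), extFrame_of_le hr]
    rw [hφ', map_add, map_smul, map_smul, h.inner_extFrame_self ht one_le_two (by omega),
      h.inner_extFrame ht (by norm_num) (by norm_num) (by norm_num)]
    simp
  rw [h.bitension_eq hL hJ hS (by omega) ht, hf, d e1 t ht, d e2 t ht, d (d e1) t ht, e1 t ht,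
    e2 t ht, e3 t ht, hφ t ht, extFrame_of_le (show 2 ≤ r by omega) t, extFrame_of_le hr t]
  have c2 : 0 - k₁ ^ 3 - k₁ * k₂ ^ 2 + (c + 3) / 4 * k₁ = -(k₁ * (3 * (c - 1) / 4 * a) * a) := by
    linear_combination (-k₁) * h12
  have c4 : k₁ * k₂ * k₃ = -(k₁ * (3 * (c - 1) / 4 * a) * b) := by
    linear_combination k₁ * h23
  rw [c2, c4]
  module

end IsFrenetCurve

end LegendreFrenetCurves

end Sasaki

end

/-! ### The classification. -/

theorem mainTheorem4 (n : ℕ) {N : Type*} [TopologicalSpace N]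
    [ChartedSpace (EuclideanSpace ℝ (Fin (2 * n + 1))) N] [IsManifold (𝓡 (2 * n + 1)) ∞ N]
    (S : Sasaki.Structure (2 * n + 1) N) (c : ℝ) (hS : S.IsSpaceForm c) (hc : c ≠ 1)
    (J : Set ℝ) (hJ : IsOpen J) (hJ' : J.OrdConnected) (hJ'' : J.Nonempty)
    (γ : ℝ → N) (r : ℕ) (E : ℕ → ∀ t, TangentSpace (𝓡 (2 * n + 1)) (γ t)) (κ : ℕ → ℝ → ℝ)
    (hγ : Sasaki.IsFrenetCurve S.g J γ r E κ) (hL : S.IsLegendre J γ)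
    -- if `E 2` exists, then `g(E₂, φT)` is none of the constant functions `0`, `1`, `-1`
    (h0 : 2 ≤ r → ¬ ∀ t ∈ J, S.g.inner (γ t) (E 2 t) (S.φ (γ t) (Sasaki.velocity γ t)) = 0)
    (h1 : 2 ≤ r → ¬ ∀ t ∈ J, S.g.inner (γ t) (E 2 t) (S.φ (γ t) (Sasaki.velocity γ t)) = 1)
    (h2 : 2 ≤ r → ¬ ∀ t ∈ J, S.g.inner (γ t) (E 2 t) (S.φ (γ t) (Sasaki.velocity γ t)) = -1) :
    (c ≤ -3 → (Sasaki.IsBiharmonic S.g J γ ↔ Sasaki.IsGeodesic S.g J γ)) ∧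
    (-3 < c → (Sasaki.IsProperBiharmonic S.g J γ ↔
      4 ≤ r ∧ ∃ α₀ : ℝ, α₀ ∈ Set.Ioo 0 (2 * Real.pi) \ {Real.pi / 2, Real.pi, 3 * Real.pi / 2} ∧
        0 < c + 3 + 3 * (c - 1) * Real.cos α₀ ^ 2 ∧
        3 * (c - 1) * Real.sin (2 * α₀) < 0 ∧
        (∀ t ∈ J, S.φ (γ t) (Sasaki.velocity γ t) =
          Real.cos α₀ • E 2 t + Real.sin α₀ • E 4 t) ∧
        ∃ k₁ k₂ k₃ : ℝ, 0 < k₁ ∧ 0 < k₂ ∧ 0 < k₃ ∧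
          (∀ t ∈ J, κ 1 t = k₁ ∧ κ 2 t = k₂ ∧ κ 3 t = k₃) ∧
          k₁ ^ 2 + k₂ ^ 2 = (c + 3) / 4 + 3 * (c - 1) / 4 * Real.cos α₀ ^ 2 ∧
          k₂ * k₃ = -(3 * (c - 1) / 8) * Real.sin (2 * α₀))) := by
  constructor
  · intro hc3
    refine ⟨fun hb => ?_, fun hg => hg.isBiharmonic hJ⟩
    by_cases hr : 2 ≤ r
    · obtain ⟨-, a, -, -, -, -, -, k₁, k₂, -, hk₁, -, -, -, h12, -⟩ :=
        hγ.exists_of_isBiharmonic hL hJ hS hc hJ' hJ'' hr (h0 hr) (h1 hr) (h2 hr) hb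
      -- For c ≤ -3 both terms on the right of `h12` are nonpositive, contradicting κ₁ > 0.
      nlinarith [sq_nonneg a, sq_nonneg k₂, pow_pos hk₁ 2]
    · exact hγ.isGeodesic_of_order_one hJ (not_le.1 hr)
  · intro _
    constructor
    · rintro ⟨hb, hh⟩
      have hr : 2 ≤ r := by
        by_contra hr
        exact hh (hγ.isGeodesic_of_order_one hJ (not_le.1 hr))
      obtain ⟨hr4, a, b, ha, hb0, hab, hφ, k₁, k₂, k₃, hk₁, hk₂, hk₃, hκ, h12, h23⟩ :=
        hγ.exists_of_isBiharmonic hL hJ hS hc hJ' hJ'' hr (h0 hr) (h1 hr) (h2 hr) hb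
      obtain ⟨α, hα, rfl, rfl⟩ := Sasaki.exists_angle ha hb0 hab
      have hsin := Real.sin_two_mul α
      have hk23 := mul_pos hk₂ hk₃
      refine ⟨hr4, α, hα, ?_, ?_, hφ, k₁, k₂, k₃, hk₁, hk₂, hk₃, hκ, h12, ?_⟩
      -- The two strict inequalities on the angle express κ₁² + κ₂² > 0 and κ₂κ₃ > 0.
      · nlinarith [pow_pos hk₁ 2, pow_pos hk₂ 2]
      · rw [hsin]; nlinarith
      · rw [hsin, h23]; ring
    · rintro ⟨hr4, α, -, -, -, hφ, k₁, k₂, k₃, -, -, -, hκ, h12, h23⟩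
      refine ⟨hγ.isBiharmonic_of_φ_velocity_eq hL hJ hS hr4 hφ hκ h12 ?_,
        hγ.not_isGeodesic hJ hJ'' (by omega)⟩
      rw [h23, Real.sin_two_mul]; ring
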